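/- Let $k$ be a finite field with algebraic closure $\overline k$, let $E$ be an elliptic curve over $k$ given by a Weierstrass equation $y^2+a_1xy+a_3y=x^3+a_2x^2+a_4x+a_6$, and let $\varphi:E\to E$ be a separable endomorphism of odd degree defined over $k$. Let $P=(x_P,y_P)\in E(\overline k)$ be a point different from the point at infinity, and write $k(P)=k(x_P,y_P)$. Suppose that the group $\ker(\varphi\circ\varphi)\subseteq E(\overline k)$ is cyclic and that all its points are $k(P)$-rational. Let $S\in k(x)$ be the $x$-coordinate map of $\varphi$, that is, the rational fraction with $x\circ\varphi=S\circ x$, and let $f\in k[x]$ be the minimal polynomial of $x_P$ over $k$. For $g\in k[x]$ let $T_S(g)\in k[x]$ denote the numerator of the rational fraction $g(S(x))$ written in lowest terms (defined up to a nonzero constant factor), and let $T_S^n$ be the $n$-fold composition of $T_S$. If $T_S(f)$ is irreducible over $k$, then $T_S^n(f)$ is irreducible over $k$ for every $n\ge 0$. -/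

import Mathlib

open Polynomial
open scoped Polynomial.Bivariate

/-- Equality of elements of an algebraic closure is decided classically (this is what the group law
on points, which is defined by cases, asks for). -/
noncomputable instance AlgebraicClosure.instDecidableEqClassical (k : Type*) [Field k] :
    DecidableEq (AlgebraicClosure k) :=
  Classical.decEq _

namespace WeierstrassCurve.Affine

variable {k : Type*} [Field k]

/-- The group `E(k̄)` of geometric points of a Weierstrass curve `E` over `k`. -/
abbrev GeomPoint (W : Affine k) : Type _ :=
  (W.baseChange (AlgebraicClosure k)).Point

/-- The coordinate function `x` in the function field `k(E)`. -/
noncomputable def xFun (W : Affine k) : W.FunctionField :=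
  algebraMap W.CoordinateRing W.FunctionField (CoordinateRing.mk W (C X))

/-- The coordinate function `y` in the function field `k(E)`. -/
noncomputable def yFun (W : Affine k) : W.FunctionField :=
  algebraMap W.CoordinateRing W.FunctionField (CoordinateRing.mk W Y)

/-- The rational function `g ∈ k(E)` is regular at the geometric affine point `(x, y)` of `E`, and
its value there is `c`: it can be written as a quotient `a / b` of polynomials in the coordinates
with `b(x, y) ≠ 0` and `c = a(x, y) / b(x, y)`. -/
def IsValueAt (W : Affine k) (g : W.FunctionField) (x y c : AlgebraicClosure k) : Prop :=
  ∃ a b : k[X][Y], aevalAeval x y b ≠ 0 ∧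
    g * algebraMap W.CoordinateRing W.FunctionField (CoordinateRing.mk W b) =
      algebraMap W.CoordinateRing W.FunctionField (CoordinateRing.mk W a) ∧
    c = aevalAeval x y a / aevalAeval x y b

/-- A non-zero endomorphism, defined over `k`, of the elliptic curve `E` over `k`: a homomorphism
`φ : E(k̄) → E(k̄)` that is given by rational functions over `k`, together with the `k`-embedding
`φ^* : k(E) → k(E)` of function fields that it induces. The homomorphism and the embedding determine
each other: at every affine geometric point `Q`, the functions `φ^* x` and `φ^* y` are both regular
if and only if `φ Q` is affine, and then their values at `Q` are the coordinates of `φ Q`.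
(The zero map, which is constant and has degree `0`, induces no embedding of function fields.) -/
structure NonzeroEnd (W : Affine k) where
  /-- The map on geometric points. -/
  toHom : W.GeomPoint →+ W.GeomPoint
  /-- The induced embedding `φ^*` of the function field. -/
  pullback : W.FunctionField →ₐ[k] W.FunctionField
  /-- The two are compatible: `φ = (φ^* x, φ^* y)`. -/
  toHom_some_iff : ∀ (x y : AlgebraicClosure k)
    (h : (W.baseChange (AlgebraicClosure k)).Nonsingular x y) (x' y' : AlgebraicClosure k)
    (h' : (W.baseChange (AlgebraicClosure k)).Nonsingular x' y'),
    toHom (.some x y h) = .some x' y' h' ↔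
      W.IsValueAt (pullback W.xFun) x y x' ∧ W.IsValueAt (pullback W.yFun) x y y'

namespace NonzeroEnd

variable {W : Affine k} (φ : W.NonzeroEnd)

/-- The degree `[k(E) : φ^* k(E)]`. -/
noncomputable def degree : ℕ :=
  Module.finrank φ.pullback.fieldRange W.FunctionField

/-- `φ` is separable if the field extension `k(E) / φ^* k(E)` is. -/
def IsSeparable : Prop :=
  Algebra.IsSeparable φ.pullback.fieldRange W.FunctionField

end NonzeroEnd

/-- The field of definition `k(P) ⊆ k̄` of a geometric point `P`, generated over `k` by its
coordinates. -/
noncomputable def fieldOfDef {W : Affine k} :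
    W.GeomPoint → IntermediateField k (AlgebraicClosure k)
  | .zero => ⊥
  | .some x y _ => IntermediateField.adjoin k {x, y}

/-! ### Existence of the `x`-coordinate map -/

lemma aeval_xFun (W : Affine k) (p : k[X]) :
    aeval W.xFun p = algebraMap W.CoordinateRing W.FunctionField (CoordinateRing.mk W (C p)) := by
  induction p using Polynomial.induction_on' with
  | add p q hp hq => simp only [map_add, hp, hq]
  | monomial n a =>
    rw [← C_mul_X_pow_eq_monomial]
    simp only [map_mul, map_pow, aeval_X, aeval_C, xFun]
    rfl

lemma algebraMap_mk_C_ne_zero (W : Affine k) {d : k[X]} (hd : d ≠ 0) :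
    algebraMap W.CoordinateRing W.FunctionField (CoordinateRing.mk W (C d)) ≠ 0 := by
  rw [Ne, map_eq_zero_iff _ (IsFractionRing.injective W.CoordinateRing W.FunctionField)]
  intro h
  have h2 : d • (1 : W.CoordinateRing) + (0 : k[X]) • CoordinateRing.mk W Y = 0 := by
    rw [CoordinateRing.smul, h]; simp
  exact hd (CoordinateRing.smul_basis_eq_zero h2).1

/-- Every rational function has the form `(p(x) + q(x) y) / d(x)`. -/
lemma exists_smul_basis_div (W : Affine k) (g : W.FunctionField) :
    ∃ p q d : k[X], d ≠ 0 ∧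
      g * algebraMap W.CoordinateRing W.FunctionField (CoordinateRing.mk W (C d)) =
        algebraMap W.CoordinateRing W.FunctionField (CoordinateRing.mk W (C p + C q * Y)) := by
  obtain ⟨⟨r, s⟩, hrs⟩ := IsLocalization.surj (nonZeroDivisors W.CoordinateRing) g
  obtain ⟨s, hs⟩ := s
  have hs0 : s ≠ 0 := nonZeroDivisors.ne_zero hs
  obtain ⟨a, b, rfl⟩ := CoordinateRing.exists_smul_basis_eq s
  set s : W.CoordinateRing := a • 1 + b • CoordinateRing.mk W Y with hsdef
  set s' : W.CoordinateRing :=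
    CoordinateRing.mk W (C a + C b * (-(Y : k[X][Y]) - C (C W.a₁ * X + C W.a₃))) with hs'
  have hN : CoordinateRing.mk W (C (Algebra.norm k[X] s)) = s * s' := by
    have h1 := CoordinateRing.coe_norm_smul_basis (W' := W) a b
    rw [map_mul] at h1
    have h2 : CoordinateRing.mk W (C a + C b * Y) = s := by
      rw [hsdef, CoordinateRing.smul, CoordinateRing.smul, map_add, map_mul, mul_one]
    rw [h2] at h1
    exact h1
  obtain ⟨p, q, hpq⟩ := CoordinateRing.exists_smul_basis_eq (r * s')
  refine ⟨p, q, Algebra.norm k[X] s, ?_, ?_⟩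
  · have : Module.Finite k[X] W.CoordinateRing :=
      Module.Finite.of_basis (CoordinateRing.basis W)
    exact Algebra.norm_ne_zero_iff.mpr hs0
  · have h2 : CoordinateRing.mk W (C p + C q * Y) = r * s' := by
      rw [← hpq, CoordinateRing.smul, CoordinateRing.smul, map_add, map_mul, mul_one]
    rw [hN, h2, map_mul, map_mul, ← mul_assoc]
    congr 1

lemma aevalAeval_polynomial {W : Affine k} {x y : AlgebraicClosure k}
    (h : (W.baseChange (AlgebraicClosure k)).Equation x y) :
    aevalAeval x y W.polynomial = 0 := by
  rw [equation_iff'] at h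
  simp only [WeierstrassCurve.baseChange, map_a₁, map_a₂, map_a₃, map_a₄, map_a₆] at h
  rw [← h, polynomial]
  simp
  ring

/-- Polynomials which agree as functions on the curve have the same values at its points. -/
lemma aevalAeval_eq_of_mk_eq {W : Affine k} {x y : AlgebraicClosure k}
    (h : (W.baseChange (AlgebraicClosure k)).Equation x y) {a b : k[X][Y]}
    (hab : CoordinateRing.mk W a = CoordinateRing.mk W b) :
    aevalAeval x y a = aevalAeval x y b := by
  obtain ⟨c, hc⟩ := AdjoinRoot.mk_eq_mk.mp hab
  rw [← sub_eq_zero, ← map_sub, hc, map_mul, aevalAeval_polynomial h, zero_mul]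

lemma yFun_equation (W : Affine k) :
    W.yFun ^ 2 + algebraMap k _ W.a₁ * W.xFun * W.yFun + algebraMap k _ W.a₃ * W.yFun =
      W.xFun ^ 3 + algebraMap k _ W.a₂ * W.xFun ^ 2 + algebraMap k _ W.a₄ * W.xFun +
        algebraMap k W.FunctionField W.a₆ := by
  have h : CoordinateRing.mk W (Y ^ 2 + C (C W.a₁) * C X * Y + C (C W.a₃) * Y) =
      CoordinateRing.mk W (C X ^ 3 + C (C W.a₂) * C X ^ 2 + C (C W.a₄) * C X + C (C W.a₆)) :=
    AdjoinRoot.mk_eq_mk.mpr ⟨1, by rw [polynomial]; simp only [map_add, map_mul, map_pow]; ring1⟩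
  have h2 := congrArg (algebraMap W.CoordinateRing W.FunctionField) h
  simp only [map_add, map_mul, map_pow] at h2
  exact h2

/-- A non-zero polynomial over `k̄` and a non-two-torsion point outside its zeros. -/
lemma exists_point_of_ne_zero (W : Affine k) [W.IsElliptic] {g : k[X]} (hg : g ≠ 0) :
    ∃ x y : AlgebraicClosure k, (W.baseChange (AlgebraicClosure k)).Equation x y ∧
      aeval x g ≠ 0 ∧ y ≠ (W.baseChange (AlgebraicClosure k)).negY x y := by
  set V := W.baseChange (AlgebraicClosure k) with hV
  have : V.IsElliptic :=
    inferInstanceAs (WeierstrassCurve.map W (algebraMap k (AlgebraicClosure k))).IsElliptic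
  have hΔ : V.Δ ≠ 0 := V.isUnit_Δ.ne_zero
  have hpsi : C (4 : AlgebraicClosure k) * X ^ 3 + C V.b₂ * X ^ 2 + C (2 * V.b₄) * X + C V.b₆
      ≠ 0 := by
    intro h0
    have h3 := congrArg (fun p => coeff p 3) h0
    have h2 := congrArg (fun p => coeff p 2) h0
    have h1 := congrArg (fun p => coeff p 1) h0
    have h6 := congrArg (fun p => coeff p 0) h0
    simp [coeff_X, coeff_C, coeff_X_pow] at h3 h2 h1 h6
    apply hΔ
    rw [WeierstrassCurve.Δ, h2, h6]
    rcases h1 with h1 | h1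
    · linear_combination (-4 * V.b₄ ^ 3) * h1
    · rw [h1]; ring
  have hg' : g.map (algebraMap k (AlgebraicClosure k)) ≠ 0 :=
    (Polynomial.map_ne_zero_iff (algebraMap k (AlgebraicClosure k)).injective).mpr hg
  obtain ⟨x, hx⟩ := Polynomial.exists_eval_ne_zero_of_natDegree_lt_card _ (mul_ne_zero hg' hpsi)
    (lt_of_lt_of_le Cardinal.natCast_lt_aleph0 (Cardinal.aleph0_le_mk _))
  rw [eval_mul, mul_ne_zero_iff] at hx
  obtain ⟨hx1, hx2⟩ := hx
  have hq : (C (1 : AlgebraicClosure k) * X ^ 2 + C (V.a₁ * x + V.a₃) * X +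
      C (-(x ^ 3 + V.a₂ * x ^ 2 + V.a₄ * x + V.a₆))).degree = 2 :=
    degree_quadratic one_ne_zero
  obtain ⟨y, hy⟩ := IsAlgClosed.exists_root _ (by rw [hq]; decide)
  simp only [IsRoot.def, eval_add, eval_mul, eval_C, eval_X, eval_pow] at hy
  refine ⟨x, y, ?_, ?_, ?_⟩
  · rw [equation_iff]; linear_combination hy
  · rwa [aeval_def, ← eval_map]
  · intro hyy
    apply hx2
    simp only [eval_add, eval_mul, eval_C, eval_X, eval_pow, WeierstrassCurve.b₂,
      WeierstrassCurve.b₄, WeierstrassCurve.b₆]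
    rw [negY] at hyy
    linear_combination (2 * y + V.a₁ * x + V.a₃) * hyy - 4 * hy

namespace NonzeroEnd

variable {W : Affine k} (φ : W.NonzeroEnd)

/-- Since `φ` commutes with negation, `x ∘ φ` is a rational function of `x` alone. -/
lemma exists_xCoordMap [W.IsElliptic] :
    ∃ S : RatFunc k, φ.pullback W.xFun = aeval W.xFun S.num / aeval W.xFun S.denom := by
  obtain ⟨p₁, q₁, d₁, hd₁, h₁⟩ := W.exists_smul_basis_div (φ.pullback W.xFun)
  obtain ⟨p₂, q₂, d₂, hd₂, h₂⟩ := W.exists_smul_basis_div (φ.pullback W.yFun)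
  have : (W.baseChange (AlgebraicClosure k)).IsElliptic :=
    inferInstanceAs (WeierstrassCurve.map W (algebraMap k (AlgebraicClosure k))).IsElliptic
  have hq : q₁ = 0 := by
    by_contra hq
    obtain ⟨x, y, hxy, hx, hy⟩ := W.exists_point_of_ne_zero
      (mul_ne_zero hq (mul_ne_zero hd₁ hd₂))
    simp only [map_mul, mul_ne_zero_iff] at hx
    obtain ⟨hxq, hx1, hx2⟩ := hx
    have key : ∀ (y : AlgebraicClosure k)
        (h : (W.baseChange (AlgebraicClosure k)).Nonsingular x y), ∃ e h',
        φ.toHom (.some x y h) = .some ((aeval x p₁ + aeval x q₁ * y) / aeval x d₁) e h' := by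
      intro y h
      have heq : (W.baseChange (AlgebraicClosure k)).Equation
          ((aeval x p₁ + aeval x q₁ * y) / aeval x d₁)
          ((aeval x p₂ + aeval x q₂ * y) / aeval x d₂) := by
        have E := congrArg φ.pullback W.yFun_equation
        simp only [map_add, map_mul, map_pow, AlgHom.commutes] at E
        set u := φ.pullback W.xFun
        set v := φ.pullback W.yFun
        set ι := algebraMap W.CoordinateRing W.FunctionField with hι
        set A : k[X][Y] := C p₁ + C q₁ * Y with hA
        set B : k[X][Y] := C p₂ + C q₂ * Y with hB
        have hC : ∀ a : k, algebraMap k W.FunctionField a = ι (CoordinateRing.mk W (C (C a))) :=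
          fun a => rfl
        have M : CoordinateRing.mk W (B ^ 2 * C d₁ ^ 3 + C (C W.a₁) * A * B * C d₁ ^ 2 * C d₂ +
              C (C W.a₃) * B * C d₁ ^ 3 * C d₂) =
            CoordinateRing.mk W (A ^ 3 * C d₂ ^ 2 + C (C W.a₂) * A ^ 2 * C d₁ * C d₂ ^ 2 +
              C (C W.a₄) * A * C d₁ ^ 2 * C d₂ ^ 2 + C (C W.a₆) * C d₁ ^ 3 * C d₂ ^ 2) := by
          apply IsFractionRing.injective W.CoordinateRing W.FunctionField
          simp only [map_add _ (_ : k[X][Y]), map_mul, map_pow, ← hι]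
          simp only [map_add ι, map_mul, map_pow, ← hC]
          rw [← h₁, ← h₂]
          linear_combination (ι (CoordinateRing.mk W (C d₁)) ^ 3 *
            ι (CoordinateRing.mk W (C d₂)) ^ 2) * E
        have N := aevalAeval_eq_of_mk_eq h.1 M
        simp only [hA, hB, map_add, map_mul, map_pow, aevalAeval_C, aevalAeval_Y, aeval_C] at N
        rw [equation_iff]
        simp only [WeierstrassCurve.baseChange, map_a₁, map_a₂, map_a₃, map_a₄, map_a₆]
        field_simp
        linear_combination N
      refine ⟨_, equation_iff_nonsingular.mp heq, ?_⟩
      rw [φ.toHom_some_iff]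
      exact ⟨⟨_, C d₁, by simpa using hx1, h₁, by simp⟩, ⟨_, C d₂, by simpa using hx2, h₂, by simp⟩⟩
    have hns := equation_iff_nonsingular.mp hxy
    obtain ⟨e, h', he⟩ := key y hns
    obtain ⟨e', h'', he'⟩ := key _ ((nonsingular_neg ..).mpr hns)
    rw [← Point.neg_some hns, map_neg, he, Point.neg_some, Point.some.injEq] at he'
    have h3 := he'.1
    rw [div_left_inj' hx1, add_right_inj, mul_right_inj' hxq] at h3
    exact hy h3
  subst hq
  refine ⟨algebraMap k[X] (RatFunc k) p₁ / algebraMap k[X] (RatFunc k) d₁, ?_⟩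
  set S := algebraMap k[X] (RatFunc k) p₁ / algebraMap k[X] (RatFunc k) d₁ with hS
  have hd : aeval W.xFun d₁ ≠ 0 := by rw [aeval_xFun]; exact W.algebraMap_mk_C_ne_zero hd₁
  have hD : aeval W.xFun S.denom ≠ 0 := by
    rw [aeval_xFun]; exact W.algebraMap_mk_C_ne_zero S.denom_ne_zero
  have h4 : S.num * d₁ = p₁ * S.denom := (RatFunc.num_mul_eq_mul_denom_iff hd₁).mpr hS
  have h5 := congrArg (aeval W.xFun) h4
  rw [map_mul, map_mul] at h5
  rw [eq_div_iff hD]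
  apply mul_right_cancel₀ hd
  rw [h5, aeval_xFun W p₁]
  simp only [map_zero, zero_mul, add_zero] at h₁
  rw [← h₁, ← aeval_xFun]
  ring

/-- The `x`-coordinate map of `φ`: the rational fraction `S ∈ k(x)` with `φ^* x = S(x)`, that is,
`x ∘ φ = S ∘ x`. -/
noncomputable def xCoordMap [W.IsElliptic] : RatFunc k :=
  φ.exists_xCoordMap.choose

lemma pullback_xFun [W.IsElliptic] :
    φ.pullback W.xFun = aeval W.xFun φ.xCoordMap.num / aeval W.xFun φ.xCoordMap.denom :=
  φ.exists_xCoordMap.choose_spec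

end NonzeroEnd

end WeierstrassCurve.Affine

/-- The `S`-transform of a polynomial `f`: the numerator, in lowest terms, of `f(S(x))`. -/
noncomputable def RatFunc.transform {k : Type*} [Field k] (S : RatFunc k) (f : k[X]) : k[X] :=
  (aeval S f).num

/-! Over a finite field, the degree of an algebraic element is the length of its orbit under
Frobenius σ. Let d = deg φ and choose a tower Q_0 = P, φ(Q_{n+1}) = Q_n. Then x(Q_n) is a root of
T_S^n(f), a nonzero polynomial of degree at most d^n deg f, so it suffices that x(Q_n) has at least
this degree over k.

Let m be the period of P under σ. As σ^m fixes k(P), it fixes ker(φ∘φ) pointwise. Irreducibility of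
T_S(f) makes all x(Q_1 + R) with R in ker φ conjugate. Since d is odd, the sign ambiguity does no
harm, and σ^m Q_1 - Q_1 has order d (`addOrderOf_pow_sub_of_orbit`). Cyclicity of ker(φ∘φ) carries
this up the tower: σ^(m d^n) moves Q_{n+1} by an element of ker φ of order d
(`addOrderOf_pow_sub_of_isAddCyclic`). Hence m d^n divides every period of Q_n
(`dvd_of_pow_apply_eq_tower`), and `natDegree_minpoly_mul_le` passes from points to x-coordinates,
again by oddness.

The geometric input is that d is both the degree of S (`degree_eq_max_natDegree`) and the order of
ker φ (`card_ker`). -/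

/-! ### Orbits under an automorphism with fixed field `k` -/

section Orbit

variable {k F : Type*} [Field k] [Field F] [Algebra k F]

lemma AlgEquiv.aeval_pow_apply_eq_zero (σ : F ≃ₐ[k] F) {x : F} {p : k[X]} (h : aeval x p = 0)
    (i : ℕ) : aeval ((σ ^ i) x) p = 0 := by
  have := congrArg (σ ^ i) h
  rw [map_zero, ← AlgEquiv.coe_toAlgHom, ← aeval_algHom_apply] at this
  exact this

/-- Pigeonhole: with d the degree of x, the d + 1 elements x, σ x, ..., σ^d x lie among at most d
roots. This turns lower bounds on periods into lower bounds on degrees. -/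
lemma AlgEquiv.exists_pow_apply_eq_le_natDegree_minpoly [Algebra.IsAlgebraic k F] (σ : F ≃ₐ[k] F)
    (x : F) : ∃ m, 0 < m ∧ m ≤ (minpoly k x).natDegree ∧ (σ ^ m) x = x := by
  classical
  have hx : IsIntegral k x := (Algebra.IsAlgebraic.isAlgebraic x).isIntegral
  have h0 := minpoly.ne_zero hx
  have hmaps : ∀ i ∈ Finset.range ((minpoly k x).natDegree + 1),
      (σ ^ i) x ∈ ((minpoly k x).aroots F).toFinset := by
    intro i _
    rw [Multiset.mem_toFinset, mem_aroots]
    exact ⟨h0, σ.aeval_pow_apply_eq_zero (minpoly.aeval k x) i⟩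
  have hcard : ((minpoly k x).aroots F).toFinset.card <
      (Finset.range ((minpoly k x).natDegree + 1)).card := by
    rw [Finset.card_range, Nat.lt_succ_iff]
    refine (Multiset.toFinset_card_le _).trans ((card_roots' _).trans ?_)
    rw [natDegree_map]
  obtain ⟨i, hi, j, hj, hij, he⟩ := Finset.exists_ne_map_eq_of_card_lt_of_maps_to hcard hmaps
  rw [Finset.mem_range] at hi hj
  have key : ∀ i j : ℕ, i < j → (σ ^ i) x = (σ ^ j) x → (σ ^ (j - i)) x = x := by
    intro i j hlt he
    apply (σ ^ i).injective
    rw [he, ← AlgEquiv.mul_apply, ← pow_add]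
    congr 2
    omega
  rcases lt_or_gt_of_ne hij with h | h
  · exact ⟨j - i, by omega, by omega, key i j h he⟩
  · exact ⟨i - j, by omega, by omega, key j i h he.symm⟩

lemma AlgEquiv.exists_map_eq_prod_orbit (σ : F ≃ₐ[k] F)
    (hσ : ∀ z, σ z = z → z ∈ Set.range (algebraMap k F)) {x : F} {m : ℕ} (h : (σ ^ m) x = x) :
    ∃ g : k[X], g.map (algebraMap k F) = ∏ i ∈ Finset.range m, (X - C ((σ ^ i) x)) := by
  set G : F[X] := ∏ i ∈ Finset.range m, (X - C ((σ ^ i) x)) with hG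
  have hmap : G.map (σ : F →+* F) = G := by
    -- Peeling the product over m + 1 indices from either end compares G with its conjugate, since
    -- the factors at 0 and at m are both X - x.
    have h1 : (X - C x) * G.map (σ : F →+* F) = G * (X - C x) := by
      have e : G.map (σ : F →+* F) = ∏ i ∈ Finset.range m, (X - C ((σ ^ (i + 1)) x)) := by
        rw [hG, Polynomial.map_prod]
        refine Finset.prod_congr rfl fun i _ => ?_
        rw [Polynomial.map_sub, map_X, map_C, pow_succ']
        rfl
      have h2 := Finset.prod_range_succ (fun i => X - C ((σ ^ i) x)) m
      rw [Finset.prod_range_succ', h] at h2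
      rw [e, mul_comm]
      exact h2
    rw [mul_comm] at h1
    exact mul_right_cancel₀ (X_sub_C_ne_zero x) h1
  have hl : G ∈ lifts (algebraMap k F) := by
    rw [lifts_iff_coeff_lifts]
    intro i
    apply hσ
    conv_rhs => rw [← hmap]
    rw [coeff_map]
    rfl
  exact (mem_lifts _).mp hl

variable (σ : F ≃ₐ[k] F) (hσ : ∀ z, σ z = z → z ∈ Set.range (algebraMap k F))
include hσ

lemma AlgEquiv.natDegree_minpoly_le {x : F} {m : ℕ} (hm : 0 < m) (h : (σ ^ m) x = x) :
    (minpoly k x).natDegree ≤ m := by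
  obtain ⟨g, hg⟩ := σ.exists_map_eq_prod_orbit hσ h
  have h0 : g.natDegree = m := by
    rw [← natDegree_map (algebraMap k F), hg, natDegree_prod_of_monic _ _ fun i _ => monic_X_sub_C _]
    simp
  have hx : aeval x g = 0 := by
    rw [← eval_map_algebraMap, hg, eval_prod]
    exact Finset.prod_eq_zero (Finset.mem_range.mpr hm) (by simp)
  rw [← h0]
  refine natDegree_le_of_dvd (minpoly.dvd k x hx) ?_
  rintro rfl
  simp at h0
  omega

/-- The product over the σ-orbit of x has coefficients in k, so the minimal polynomial divides it
and has no roots outside the orbit. -/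
lemma AlgEquiv.exists_pow_apply_eq_of_aeval_minpoly [Algebra.IsAlgebraic k F] {x x' : F}
    (h' : aeval x' (minpoly k x) = 0) : ∃ i, (σ ^ i) x = x' := by
  obtain ⟨m, hm, -, h⟩ := σ.exists_pow_apply_eq_le_natDegree_minpoly x
  obtain ⟨g, hg⟩ := σ.exists_map_eq_prod_orbit hσ h
  have hx : aeval x g = 0 := by
    rw [← eval_map_algebraMap, hg, eval_prod]
    exact Finset.prod_eq_zero (Finset.mem_range.mpr hm) (by simp)
  have hx' : aeval x' g = 0 := aeval_eq_zero_of_dvd_aeval_eq_zero (minpoly.dvd k x hx) h'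
  rw [← eval_map_algebraMap, hg, eval_prod, Finset.prod_eq_zero_iff] at hx'
  obtain ⟨i, -, hi⟩ := hx'
  rw [eval_sub, eval_X, eval_C, sub_eq_zero] at hi
  exact ⟨i, hi.symm⟩

end Orbit

/-- For the q-power Frobenius a fixed point is a root of X^q - X, which already splits over k. -/
lemma FiniteField.exists_algEquiv_fixed_eq_range (k F : Type*) [Field k] [Finite k] [Field F]
    [Algebra k F] [Algebra.IsAlgebraic k F] :
    ∃ σ : F ≃ₐ[k] F, ∀ z, σ z = z → z ∈ Set.range (algebraMap k F) := by
  have := Fintype.ofFinite k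
  refine ⟨FiniteField.frobeniusAlgEquivOfAlgebraic k F, fun z hz => ?_⟩
  rw [FiniteField.coe_frobeniusAlgEquivOfAlgebraic] at hz
  have hroot : z ∈ (((X ^ Fintype.card k - X : k[X])).aroots F) := by
    rw [mem_aroots]
    refine ⟨FiniteField.X_pow_card_sub_X_ne_zero k Fintype.one_lt_card, ?_⟩
    simpa [sub_eq_zero] using hz
  have hs : ((X ^ Fintype.card k - X : k[X])).Splits := by
    rw [splits_iff_card_roots, FiniteField.roots_X_pow_card_sub_X,
      FiniteField.X_pow_card_sub_X_natDegree_eq k Fintype.one_lt_card]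
    rfl
  rw [aroots_def, hs.roots_map, Multiset.mem_map] at hroot
  obtain ⟨c, -, hc⟩ := hroot
  exact ⟨c, hc⟩

/-! ### The transform of a polynomial -/

namespace RatFunc

variable {k : Type*} [Field k] (S : RatFunc k)

/-- The homogenization of `f` evaluated at the numerator and denominator of `S`. -/
noncomputable def homogNum (f : k[X]) : k[X] :=
  ∑ i ∈ Finset.range (f.natDegree + 1),
    Polynomial.C (f.coeff i) * S.num ^ i * S.denom ^ (f.natDegree - i)

lemma aeval_eq_div (f : k[X]) :
    aeval S f = algebraMap k[X] (RatFunc k) (S.homogNum f) /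
      algebraMap k[X] (RatFunc k) (S.denom ^ f.natDegree) := by
  have hb : algebraMap k[X] (RatFunc k) S.denom ≠ 0 := algebraMap_ne_zero S.denom_ne_zero
  have hS : S * algebraMap k[X] (RatFunc k) S.denom = algebraMap k[X] (RatFunc k) S.num := by
    nth_rw 1 [← num_div_denom S]
    rw [div_mul_cancel₀ _ hb]
  rw [map_pow, eq_div_iff (pow_ne_zero _ hb), aeval_eq_sum_range, Finset.sum_mul, homogNum, map_sum]
  refine Finset.sum_congr rfl fun i hi => ?_
  rw [Finset.mem_range, Nat.lt_succ_iff] at hi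
  rw [map_mul, map_mul, map_pow, map_pow, ← hS, mul_pow, Algebra.smul_def,
    ← Nat.sub_add_cancel hi, pow_add, Nat.sub_add_cancel hi]
  rw [show algebraMap k[X] (RatFunc k) (Polynomial.C (f.coeff i)) =
       algebraMap k (RatFunc k) (f.coeff i) from rfl]
  ring

variable {S}

lemma transform_ne_zero (hS : ¬∃ c, S = C c) {f : k[X]} (hf : f ≠ 0) : S.transform f ≠ 0 := by
  rw [transform, Ne, num_eq_zero_iff]
  intro h
  exact hf ((transcendental_iff.mp (S.transcendental_of_ne_C hS)) f h)

/-- For general S the degree drops when f vanishes at S(∞). The upper bound suffices here, since the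
lower bound comes from a root. -/
lemma natDegree_transform_le (f : k[X]) :
    (S.transform f).natDegree ≤ max S.num.natDegree S.denom.natDegree * f.natDegree := by
  by_cases h0 : S.homogNum f = 0
  · rw [transform, aeval_eq_div, h0]
    simp
  have hd : S.transform f ∣ S.homogNum f := by
    rw [transform, aeval_eq_div]
    exact num_div_dvd _ (pow_ne_zero _ S.denom_ne_zero)
  refine (natDegree_le_of_dvd hd h0).trans ?_
  refine natDegree_sum_le_of_forall_le _ _ fun i hi => ?_
  rw [Finset.mem_range, Nat.lt_succ_iff] at hi
  rw [mul_assoc]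
  refine (natDegree_C_mul_le _ _).trans (natDegree_mul_le.trans ?_)
  refine (add_le_add natDegree_pow_le natDegree_pow_le).trans ?_
  calc i * S.num.natDegree + (f.natDegree - i) * S.denom.natDegree
      ≤ i * max S.num.natDegree S.denom.natDegree +
        (f.natDegree - i) * max S.num.natDegree S.denom.natDegree := by
          gcongr
          · exact le_max_left _ _
          · exact le_max_right _ _
    _ = _ := by rw [← add_mul, Nat.add_sub_of_le hi, mul_comm]

lemma aeval_transform_eq_zero {F : Type*} [Field F] [Algebra k F] {f : k[X]} {x x' : F}
    (hx : aeval x S.denom ≠ 0) (hx' : aeval x S.num = x' * aeval x S.denom)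
    (hf : aeval x' f = 0) : aeval x (S.transform f) = 0 := by
  have h := (num_mul_eq_mul_denom_iff (pow_ne_zero f.natDegree S.denom_ne_zero)).mpr
    (S.aeval_eq_div f)
  have h1 := congrArg (aeval x) h
  rw [map_mul, map_mul, map_pow] at h1
  have h2 : aeval x (S.homogNum f) = 0 := by
    have h3 : aeval x (S.homogNum f) = aeval x' f * aeval x S.denom ^ f.natDegree := by
      rw [homogNum, map_sum, aeval_eq_sum_range, Finset.sum_mul]
      refine Finset.sum_congr rfl fun i hi => ?_
      rw [Finset.mem_range, Nat.lt_succ_iff] at hi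
      rw [map_mul, map_mul, map_pow, map_pow, hx', mul_pow, Algebra.smul_def, aeval_C]
      rw [← Nat.sub_add_cancel hi, pow_add, Nat.sub_add_cancel hi]
      ring
    rw [h3, hf, zero_mul]
  rw [h2, zero_mul] at h1
  exact (mul_eq_zero.mp h1).resolve_right (pow_ne_zero _ hx)

end RatFunc

/-! ### Towers of preimages in an abelian group with an automorphism -/

section Group

variable {A : Type*} [AddCommGroup A]

lemma AddMonoid.End.apply_mul (f g : AddMonoid.End A) (x : A) : (f * g) x = f (g x) :=
  rfl

lemma AddMonoid.End.pow_apply_of_sub_fixed {τ : AddMonoid.End A} {Q : A}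
    (h : τ (τ Q - Q) = τ Q - Q) (i : ℕ) : (τ ^ i) Q = Q + i • (τ Q - Q) := by
  induction i with
  | zero => simp
  | succ i ih =>
    rw [pow_succ', AddMonoid.End.apply_mul, ih, map_add, map_nsmul, h, succ_nsmul]
    abel

lemma AddMonoid.End.pow_apply_eq_self {τ : AddMonoid.End A} {Q : A} (h : τ Q = Q) (i : ℕ) :
    (τ ^ i) Q = Q := by
  induction i with
  | zero => rfl
  | succ i ih => rw [pow_succ', AddMonoid.End.apply_mul, ih, h]

lemma AddMonoid.End.map_pow_apply {φ : A →+ A} {τ : AddMonoid.End A}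
    (h : ∀ x, φ (τ x) = τ (φ x)) (i : ℕ) (x : A) : φ ((τ ^ i) x) = (τ ^ i) (φ x) := by
  induction i with
  | zero => rfl
  | succ i ih => rw [pow_succ', AddMonoid.End.apply_mul, h, ih, AddMonoid.End.apply_mul]

variable {φ : A →+ A} {N : ℕ}

/-- The displacement R₂ of Q₂ lies in ker(φ∘φ), where τ acts trivially, so τ^N moves Q₂ by N R₂. If
g generates ker(φ∘φ) and R₂ = c g, then c φ(g) has order N, which makes c prime to N; and N g
generates ker φ, so N R₂ = c (N g) still has order N. -/
lemma addOrderOf_pow_sub_of_isAddCyclic {τ : AddMonoid.End A} (hcomm : ∀ x, φ (τ x) = τ (φ x))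
    (hcyc : IsAddCyclic (φ.comp φ).ker) (hN : Nat.card φ.ker = N) (hN0 : 0 < N)
    (hfix : ∀ R, φ (φ R) = 0 → τ R = R) {Q₁ Q₂ : A} (hQ : φ Q₂ = Q₁)
    (hker : φ (τ Q₁ - Q₁) = 0) (hord : addOrderOf (τ Q₁ - Q₁) = N) :
    (τ ^ N) Q₁ = Q₁ ∧ φ ((τ ^ N) Q₂ - Q₂) = 0 ∧ addOrderOf ((τ ^ N) Q₂ - Q₂) = N := by
  set R₂ := τ Q₂ - Q₂ with hR₂
  have hφR₂ : φ R₂ = τ Q₁ - Q₁ := by rw [hR₂, map_sub, hcomm, hQ]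
  have h1 : (τ ^ N) Q₁ = Q₁ := by
    rw [AddMonoid.End.pow_apply_of_sub_fixed (hfix _ (by rw [hker, map_zero])), ← hord,
      addOrderOf_nsmul_eq_zero, add_zero]
  have hφφ : φ (φ R₂) = 0 := by rw [hφR₂, hker]
  have h2 : (τ ^ N) Q₂ - Q₂ = N • R₂ := by
    rw [AddMonoid.End.pow_apply_of_sub_fixed (hfix _ hφφ)]
    abel
  refine ⟨h1, ?_, ?_⟩
  · rw [map_sub, AddMonoid.End.map_pow_apply hcomm, hQ, h1, sub_self]
  rw [h2]
  obtain ⟨⟨g, hg⟩, hgen⟩ := hcyc.exists_zsmul_surjective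
  have hgφ : φ (φ g) = 0 := hg
  have hgen' : ∀ R, φ (φ R) = 0 → ∃ c : ℤ, c • g = R := by
    intro R hR
    obtain ⟨c, hc⟩ := hgen ⟨R, hR⟩
    exact ⟨c, congrArg Subtype.val hc⟩
  have hkerN : ∀ R, φ R = 0 → N • R = 0 := by
    intro R hR
    have : Nat.card φ.ker • (⟨R, hR⟩ : φ.ker) = 0 := card_nsmul_eq_zero'
    rw [hN] at this
    exact congrArg Subtype.val this
  obtain ⟨c, hc⟩ := hgen' R₂ hφφ
  have hcφ : c • φ g = τ Q₁ - Q₁ := by rw [← map_zsmul, hc, hφR₂]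
  have hordφg : addOrderOf (φ g) = N := by
    apply Nat.dvd_antisymm
    · exact addOrderOf_dvd_of_nsmul_eq_zero (hkerN _ hgφ)
    · rw [← hord, ← hcφ]
      exact addOrderOf_dvd_of_nsmul_eq_zero
        (by rw [smul_comm, addOrderOf_nsmul_eq_zero, smul_zero])
  -- the kernel of `φ` is generated by `N • g`
  have hker_le : φ.ker = AddSubgroup.zmultiples (N • g) := by
    ext R
    rw [AddMonoidHom.mem_ker, AddSubgroup.mem_zmultiples_iff]
    constructor
    · intro hR
      obtain ⟨t, ht⟩ := hgen' R (by rw [hR, map_zero])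
      have : t • φ g = 0 := by rw [← map_zsmul, ht, hR]
      rw [← addOrderOf_dvd_iff_zsmul_eq_zero, hordφg] at this
      obtain ⟨u, rfl⟩ := this
      exact ⟨u, by rw [← ht, mul_comm, mul_smul, natCast_zsmul]⟩
    · rintro ⟨u, rfl⟩
      rw [map_zsmul, map_nsmul, ← hordφg, addOrderOf_nsmul_eq_zero, smul_zero]
  have hordN : addOrderOf (N • g) = N := by
    rw [← Nat.card_zmultiples, ← hker_le, hN]
  have hcop : IsCoprime c (N : ℤ) := by
    -- By counting, c φ(g) generates ker φ, so φ(g) is a multiple of it; the multiplier e inverts c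
    -- modulo N.
    obtain ⟨e, he⟩ : ∃ e : ℤ, e • (c • φ g) = φ g := by
      have h3 : AddSubgroup.zmultiples (c • φ g) = φ.ker := by
        have hfin : Finite φ.ker := Nat.finite_of_card_ne_zero (by omega)
        refine AddSubgroup.eq_of_le_of_card_ge ?_ ?_
        · rw [AddSubgroup.zmultiples_le, AddMonoidHom.mem_ker, map_zsmul, hgφ, smul_zero]
        · rw [hN, Nat.card_zmultiples, hcφ, hord]
      have h4 : φ g ∈ φ.ker := hgφ
      rw [← h3, AddSubgroup.mem_zmultiples_iff] at h4
      exact h4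
    have h5 : (e * c - 1) • φ g = 0 := by rw [sub_smul, mul_smul, he, one_smul, sub_self]
    rw [← addOrderOf_dvd_iff_zsmul_eq_zero, hordφg] at h5
    obtain ⟨u, hu⟩ := h5
    exact ⟨e, -u, by linear_combination hu⟩
  obtain ⟨u, v, huv⟩ := hcop
  rw [← hc]
  apply Nat.dvd_antisymm
  · apply addOrderOf_dvd_of_nsmul_eq_zero
    rw [smul_comm N c g]
    nth_rw 1 [← hordN]
    rw [smul_comm, addOrderOf_nsmul_eq_zero, smul_zero]
  · have h6 : N • g = u • (N • c • g) := by
      rw [smul_comm N c g, ← mul_smul]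
      have h7 : (u * c + v * N) • (N • g) = N • g := by rw [huv, one_smul]
      have h8 : N • (N • g) = 0 := by
        nth_rw 1 [← hordN]
        exact addOrderOf_nsmul_eq_zero _
      rw [add_smul, mul_smul v, natCast_zsmul, h8, smul_zero, add_zero] at h7
      exact h7.symm
    nth_rw 1 [← hordN]
    rw [h6]
    exact addOrderOf_dvd_of_nsmul_eq_zero
      (by rw [smul_comm, addOrderOf_nsmul_eq_zero, smul_zero])

/-- If every translate of `Q` by the kernel lies, up to sign, in the orbit of `Q`, and the kernel
has odd order, then the translations realised by the stabiliser of `φ Q` exhaust the kernel. -/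
lemma addOrderOf_pow_sub_of_orbit {π : AddMonoid.End A} (hcomm : ∀ x, φ (π x) = π (φ x))
    (hN : Nat.card φ.ker = N) (hodd : Odd N) {m : ℕ} {Q : A}
    (hP : (π ^ m) (φ Q) = φ Q) (hm : ∀ i, (π ^ i) (φ Q) = φ Q → m ∣ i)
    (hfix : ∀ R, φ R = 0 → (π ^ m) R = R)
    (horb : ∀ R, φ R = 0 → ∃ i, (π ^ i) Q = Q + R ∨ (π ^ i) Q = -(Q + R)) :
    addOrderOf ((π ^ m) Q - Q) = N := by
  set R₁ := (π ^ m) Q - Q with hR₁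
  have hφR₁ : φ R₁ = 0 := by
    rw [hR₁, map_sub, AddMonoid.End.map_pow_apply hcomm, hP, sub_self]
  -- A power translating Q by a kernel element stabilises φ Q, hence is a power of π^m, which
  -- translates Q by R₁.
  have hA : ∀ i R, φ R = 0 → (π ^ i) Q = Q + R → R ∈ AddSubgroup.zmultiples R₁ := by
    intro i R hR hi
    obtain ⟨t, rfl⟩ := hm i (by
      rw [← AddMonoid.End.map_pow_apply hcomm, hi, map_add, hR, add_zero])
    rw [pow_mul, AddMonoid.End.pow_apply_of_sub_fixed (hfix _ hφR₁), add_right_inj] at hi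
    rw [← hi]
    exact AddSubgroup.nsmul_mem_zmultiples _ _
  -- Two powers that both reverse the sign differ by a π^t that stabilises φ Q, fixes the kernel and
  -- translates Q by R' - R.
  have hB : ∀ i t R R', φ R = 0 → φ R' = 0 → (π ^ i) Q = -(Q + R) →
      (π ^ (i + t)) Q = -(Q + R') → R' - R ∈ AddSubgroup.zmultiples R₁ := by
    intro i t R R' hR hR' h h'
    rw [add_comm, pow_add, AddMonoid.End.apply_mul, h, map_neg, neg_inj, map_add] at h'
    have ht : m ∣ t := by
      apply hm
      have := congrArg φ h'
      rwa [map_add, map_add, hR', AddMonoid.End.map_pow_apply hcomm,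
        AddMonoid.End.map_pow_apply hcomm, hR, map_zero, add_zero, add_zero] at this
    apply hA t _ (by rw [map_sub, hR, hR', sub_zero])
    have : (π ^ t) R = R := by
      obtain ⟨s, rfl⟩ := ht
      rw [pow_mul, AddMonoid.End.pow_apply_eq_self (hfix R hR)]
    rw [this] at h'
    rw [eq_sub_of_add_eq h']
    abel
  have hall : φ.ker = AddSubgroup.zmultiples R₁ := by
    apply le_antisymm
    · intro R hR
      rw [AddMonoidHom.mem_ker] at hR
      -- If R is reached only with a minus sign, compare with 2R: reached with a plus sign it gives
      -- R by halving in odd order, with a minus sign the difference 2R - R is R itself.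
      have hR2 : φ (2 • R) = 0 := by rw [map_nsmul, hR, smul_zero]
      have hfromtwo : 2 • R ∈ AddSubgroup.zmultiples R₁ → R ∈ AddSubgroup.zmultiples R₁ := by
        intro h2
        obtain ⟨r, hr⟩ := hodd
        have hz : N • R = 0 := by
          have : Nat.card φ.ker • (⟨R, hR⟩ : φ.ker) = 0 := card_nsmul_eq_zero'
          rw [hN] at this
          exact congrArg Subtype.val this
        have h3 : R = (r + 1) • (2 • R) := by
          rw [← mul_smul, show (r + 1) * 2 = N + 1 by omega, succ_nsmul, hz, zero_add]
        rw [h3]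
        exact AddSubgroup.nsmul_mem _ h2 _
      obtain ⟨i, hi | hi⟩ := horb R hR
      · exact hA i R hR hi
      obtain ⟨j, hj | hj⟩ := horb (2 • R) hR2
      · exact hfromtwo (hA j _ hR2 hj)
      rcases le_total i j with hij | hij
      · obtain ⟨t, rfl⟩ := Nat.exists_eq_add_of_le hij
        have := hB i t R (2 • R) hR hR2 hi hj
        rwa [two_nsmul, add_sub_cancel_right] at this
      · obtain ⟨t, rfl⟩ := Nat.exists_eq_add_of_le hij
        have := hB j t (2 • R) R hR2 hR hj hi
        rw [← neg_mem_iff, neg_sub, two_nsmul, add_sub_cancel_right] at this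
        exact this
    · rw [AddSubgroup.zmultiples_le]
      exact hφR₁
  rw [← Nat.card_zmultiples, ← hall, hN]

lemma dvd_of_pow_apply_eq_tower {π : AddMonoid.End A} (hcomm : ∀ x, φ (π x) = π (φ x))
    (hcyc : IsAddCyclic (φ.comp φ).ker) (hN : Nat.card φ.ker = N) (hN0 : 0 < N) {m : ℕ}
    (hfix : ∀ R, φ (φ R) = 0 → (π ^ m) R = R) {Q : ℕ → A} (hQ : ∀ n, φ (Q (n + 1)) = Q n)
    (hP : (π ^ m) (Q 0) = Q 0) (hm : ∀ i, (π ^ i) (Q 0) = Q 0 → m ∣ i)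
    (hord : addOrderOf ((π ^ m) (Q 1) - Q 1) = N) (n : ℕ) :
    ∀ i, (π ^ i) (Q n) = Q n → m * N ^ n ∣ i := by
  have hcomm' := AddMonoid.End.map_pow_apply hcomm
  have hfix' : ∀ n R, φ (φ R) = 0 → (π ^ (m * N ^ n)) R = R := by
    intro n R hR
    rw [pow_mul, AddMonoid.End.pow_apply_eq_self (hfix R hR)]
  have key : ∀ n, (π ^ (m * N ^ n)) (Q n) = Q n ∧
      φ ((π ^ (m * N ^ n)) (Q (n + 1)) - Q (n + 1)) = 0 ∧
      addOrderOf ((π ^ (m * N ^ n)) (Q (n + 1)) - Q (n + 1)) = N := by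
    intro n
    induction n with
    | zero =>
      rw [pow_zero, mul_one]
      exact ⟨hP, by rw [map_sub, hcomm', hQ, hP, sub_self], hord⟩
    | succ n ih =>
      rw [pow_succ, ← mul_assoc, pow_mul]
      exact addOrderOf_pow_sub_of_isAddCyclic (hcomm' _) hcyc hN hN0 (hfix' n) (hQ (n + 1))
        ih.2.1 ih.2.2
  induction n with
  | zero =>
    intro i hi
    rw [pow_zero, mul_one]
    exact hm i hi
  | succ n ih =>
    intro i hi
    -- A period of Q (n + 1) is one of its image Q n, so it is m N^n t; then t times a displacement
    -- of order N vanishes, and N divides t.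
    obtain ⟨t, rfl⟩ := ih i (by rw [← hQ n, ← hcomm', hi])
    rw [pow_mul, AddMonoid.End.pow_apply_of_sub_fixed
      (hfix' n _ (by rw [(key n).2.1, map_zero])), add_eq_left,
      ← addOrderOf_dvd_iff_nsmul_eq_zero, (key n).2.2] at hi
    rw [pow_succ, ← mul_assoc]
    exact Nat.mul_dvd_mul_left _ hi

end Group

/-! ### The degree of an endomorphism, computed in the function field. -/

namespace WeierstrassCurve.Affine

variable {k : Type*} [Field k]

section FunctionField

open IntermediateField

lemma transcendental_xFun (W : Affine k) : Transcendental k W.xFun := by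
  rw [transcendental_iff]
  intro p hp
  by_contra h
  rw [aeval_xFun] at hp
  exact W.algebraMap_mk_C_ne_zero h hp

/-- The Weierstrass equation makes y integral over k(x). Finiteness is all that is needed: [k(E) :
k(x)] cancels in the degree formula. -/
lemma finrank_adjoin_xFun_ne_zero (W : Affine k) :
    Module.finrank k⟮W.xFun⟯ W.FunctionField ≠ 0 := by
  set K := k⟮W.xFun⟯ with hK
  have hpoly : ∀ p : k[X], ∃ c : K, algebraMap K W.FunctionField c = aeval W.xFun p := fun p =>
    ⟨aeval (AdjoinSimple.gen k W.xFun) p, by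
      rw [← aeval_algebraMap_apply, AdjoinSimple.algebraMap_gen]⟩
  have hint : _root_.IsIntegral K W.yFun := by
    obtain ⟨s, hs⟩ := hpoly (C W.a₁ * X + C W.a₃)
    obtain ⟨t, ht⟩ := hpoly (X ^ 3 + C W.a₂ * X ^ 2 + C W.a₄ * X + C W.a₆)
    refine ⟨X ^ 2 + (C s * X - C t), ?_, ?_⟩
    · refine monic_X_pow_add ?_
      compute_degree!
    · simp only [eval₂_add, eval₂_sub, eval₂_mul, eval₂_pow, eval₂_X, eval₂_C, hs, ht]
      simp only [map_add, map_mul, map_pow, aeval_X, aeval_C]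
      linear_combination W.yFun_equation
  have htop : IntermediateField.adjoin K {W.yFun} = ⊤ := by
    rw [eq_top_iff]
    intro g _
    obtain ⟨p, q, d, hd, h⟩ := W.exists_smul_basis_div g
    have hmem : ∀ p : k[X], aeval W.xFun p ∈ IntermediateField.adjoin K {W.yFun} := by
      intro p
      obtain ⟨c, hc⟩ := hpoly p
      rw [← hc]
      exact IntermediateField.algebraMap_mem _ c
    have hd' : aeval W.xFun d ≠ 0 := by rw [aeval_xFun]; exact W.algebraMap_mk_C_ne_zero hd
    rw [← aeval_xFun, map_add, map_mul, map_add, map_mul, ← aeval_xFun, ← aeval_xFun] at h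
    rw [eq_div_of_mul_eq hd' h]
    exact div_mem (add_mem (hmem p) (mul_mem (hmem q) (mem_adjoin_simple_self K W.yFun))) (hmem d)
  have hfin : FiniteDimensional K (IntermediateField.adjoin K {W.yFun}) :=
    adjoin.finiteDimensional hint
  rw [← IntermediateField.finrank_top', ← htop]
  exact Module.finrank_pos.ne'

namespace NonzeroEnd

variable {W : Affine k} [W.IsElliptic] (φ : W.NonzeroEnd)

/-- The degree of an endomorphism is the degree of its `x`-coordinate map. -/
lemma degree_eq_max_natDegree :
    φ.degree = max φ.xCoordMap.num.natDegree φ.xCoordMap.denom.natDegree := by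
  set S := φ.xCoordMap with hS
  set e : RatFunc k →ₐ[k] W.FunctionField := k⟮W.xFun⟯.val.comp
    (RatFunc.algEquivOfTranscendental W.xFun W.transcendental_xFun).toAlgHom with he
  have heX : e RatFunc.X = W.xFun := RatFunc.algEquivOfTranscendental_X _ W.transcendental_xFun
  have heS : e S = φ.pullback W.xFun := by
    rw [φ.pullback_xFun, ← RatFunc.algEquivOfTranscendental_apply _ W.transcendental_xFun]
    rfl
  have h1 : (⊤ : IntermediateField k (RatFunc k)).map e = k⟮W.xFun⟯ := by
    rw [← RatFunc.adjoin_X, adjoin_map, Set.image_singleton, heX]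
  have h2 : k⟮S⟯.map e = k⟮φ.pullback W.xFun⟯ := by
    rw [adjoin_map, Set.image_singleton, heS]
  have h3 : k⟮W.xFun⟯.map φ.pullback = k⟮φ.pullback W.xFun⟯ := by
    rw [adjoin_map, Set.image_singleton]
  have h4 : (⊤ : IntermediateField k W.FunctionField).map φ.pullback = φ.pullback.fieldRange :=
    (AlgHom.fieldRange_eq_map _).symm
  -- Compute [k(E) : k(φ^* x)] through φ^* k(E) and through k(x). The embedding φ^* preserves [k(E)
  -- : k(x)], so this factor occurs on both sides.
  have h5 := relfinrank_map_map (k⟮W.xFun⟯) ⊤ φ.pullback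
  have h6 := relfinrank_map_map (k⟮S⟯) ⊤ e
  rw [h3, h4, relfinrank_top_right] at h5
  rw [h1, h2, relfinrank_top_right, RatFunc.finrank_eq_max_natDegree] at h6
  have h7 : k⟮φ.pullback W.xFun⟯ ≤ φ.pullback.fieldRange := by
    rw [← h3, ← h4]
    exact IntermediateField.map_mono _ le_top
  have h8 : k⟮φ.pullback W.xFun⟯ ≤ k⟮W.xFun⟯ := by
    rw [← h1, ← h2]
    exact IntermediateField.map_mono _ le_top
  have h9 := relfinrank_mul_finrank_top h7
  rw [h5, ← relfinrank_mul_finrank_top h8, h6, mul_comm] at h9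
  exact Nat.eq_of_mul_eq_mul_right (Nat.pos_of_ne_zero W.finrank_adjoin_xFun_ne_zero) h9

end NonzeroEnd

end FunctionField

/-! ### Geometric points -/

section GeomPoint

variable {W : Affine k}

/-- The action of an automorphism of `k̄` over `k` on geometric points. -/
noncomputable def GeomPoint.galois (σ : AlgebraicClosure k ≃ₐ[k] AlgebraicClosure k) :
    AddMonoid.End W.GeomPoint :=
  Point.map (W' := W) σ.toAlgHom

lemma GeomPoint.galois_some (σ : AlgebraicClosure k ≃ₐ[k] AlgebraicClosure k)
    {x y : AlgebraicClosure k} (h : (W.baseChange (AlgebraicClosure k)).Nonsingular x y) :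
    ∃ h', GeomPoint.galois (W := W) σ (.some x y h) = .some (σ x) (σ y) h' :=
  ⟨_, rfl⟩

lemma GeomPoint.galois_pow_some (σ : AlgebraicClosure k ≃ₐ[k] AlgebraicClosure k) (i : ℕ)
    {x y : AlgebraicClosure k} (h : (W.baseChange (AlgebraicClosure k)).Nonsingular x y) :
    ∃ h', (GeomPoint.galois (W := W) σ ^ i) (.some x y h) = .some ((σ ^ i) x) ((σ ^ i) y) h' := by
  induction i with
  | zero => exact ⟨h, rfl⟩
  | succ i ih =>
    obtain ⟨h', ih⟩ := ih
    rw [pow_succ' (galois σ), AddMonoid.End.apply_mul, ih, pow_succ']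
    exact GeomPoint.galois_some σ h'

lemma IsValueAt.map {g : W.FunctionField} {x y c : AlgebraicClosure k} (h : W.IsValueAt g x y c)
    (σ : AlgebraicClosure k ≃ₐ[k] AlgebraicClosure k) :
    W.IsValueAt g (σ x) (σ y) (σ c) := by
  have key : ∀ a : k[X][Y], aevalAeval (σ x) (σ y) a = σ (aevalAeval x y a) := by
    intro a
    have : (aevalAeval (σ x) (σ y) : k[X][Y] →ₐ[k] AlgebraicClosure k) =
        σ.toAlgHom.comp (aevalAeval x y) := by
      ext <;> simp
    rw [this]
    rfl
  obtain ⟨a, b, hb, hg, hc⟩ := h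
  exact ⟨a, b, by rwa [key, Ne, map_eq_zero_iff _ σ.injective], hg, by rw [key, key, hc, map_div₀]⟩

namespace NonzeroEnd

variable (φ : W.NonzeroEnd)

lemma toHom_galois (σ : AlgebraicClosure k ≃ₐ[k] AlgebraicClosure k) (Q : W.GeomPoint) :
    φ.toHom (GeomPoint.galois σ Q) = GeomPoint.galois σ (φ.toHom Q) := by
  have key : ∀ (σ : AlgebraicClosure k ≃ₐ[k] AlgebraicClosure k) {x y : AlgebraicClosure k}
      (h : (W.baseChange (AlgebraicClosure k)).Nonsingular x y) (h₁) {x' y' : AlgebraicClosure k}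
      (h' : (W.baseChange (AlgebraicClosure k)).Nonsingular x' y'),
      φ.toHom (.some x y h) = .some x' y' h' →
      ∃ h₂, φ.toHom (.some (σ x) (σ y) h₁) = .some (σ x') (σ y') h₂ := by
    intro σ x y h h₁ x' y' h' he
    obtain ⟨h₂, -⟩ := GeomPoint.galois_some (W := W) σ h'
    rw [φ.toHom_some_iff] at he
    exact ⟨h₂, (φ.toHom_some_iff ..).mpr ⟨he.1.map σ, he.2.map σ⟩⟩
  rcases Q with _ | ⟨x, y, h⟩
  · change φ.toHom (GeomPoint.galois σ 0) = GeomPoint.galois σ (φ.toHom 0)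
    simp only [map_zero]
  · obtain ⟨h₁, e₁⟩ := GeomPoint.galois_some (W := W) σ h
    rw [e₁]
    rcases he : φ.toHom (.some x y h) with _ | ⟨x', y', h'⟩
    · change _ = GeomPoint.galois σ 0
      rw [map_zero]
      rcases he' : φ.toHom (.some (σ x) (σ y) h₁) with _ | ⟨x', y', h'⟩
      · rfl
      -- An affine image of the conjugate point would be carried back by σ⁻¹ to an affine image of
      -- the point itself.
      · obtain ⟨h₂, h₃⟩ := key σ.symm h₁ (by simpa using h) h' he'
        simp only [AlgEquiv.symm_apply_apply] at h₃
        rw [he] at h₃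
        exact absurd h₃ (by intro h; cases h)
    · obtain ⟨h₂, h₃⟩ := key σ h h₁ h' he
      rw [h₃]
      rfl

end NonzeroEnd

/-- This is how rationality over k(P) enters: a power of σ fixing P fixes k(P) pointwise. -/
lemma GeomPoint.galois_pow_eq_self (σ : AlgebraicClosure k ≃ₐ[k] AlgebraicClosure k) (m : ℕ)
    {P R : W.GeomPoint} (hR : fieldOfDef R ≤ fieldOfDef P)
    (hP : (GeomPoint.galois σ ^ m) P = P) : (GeomPoint.galois σ ^ m) R = R := by
  rcases R with _ | ⟨x, y, h⟩
  · exact map_zero _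
  have hfix : ∀ z ∈ fieldOfDef P, (σ ^ m) z = z := by
    rcases P with _ | ⟨u, v, h'⟩
    · intro z hz
      obtain ⟨c, rfl⟩ := IntermediateField.mem_bot.mp hz
      exact (σ ^ m).commutes c
    · obtain ⟨h₁, e⟩ := GeomPoint.galois_pow_some (W := W) σ m h'
      rw [e, Point.some.injEq] at hP
      intro z hz
      have hle : IntermediateField.adjoin k {u, v} ≤
          (AlgHom.equalizer (σ ^ m).toAlgHom (AlgHom.id k _)).toIntermediateField fun x hx => by
            rw [AlgHom.mem_equalizer] at hx ⊢
            rw [map_inv₀, map_inv₀, hx] := by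
        rw [IntermediateField.adjoin_le_iff]
        rintro w (rfl | rfl)
        · exact hP.1
        · exact hP.2
      exact hle hz
  obtain ⟨h₁, e⟩ := GeomPoint.galois_pow_some (W := W) σ m h
  rw [e, Point.some.injEq]
  exact ⟨hfix x (hR (IntermediateField.subset_adjoin _ _ (by simp))),
    hfix y (hR (IntermediateField.subset_adjoin _ _ (by simp)))⟩

end GeomPoint

end WeierstrassCurve.Affine

/-! ### Fibres and derivative of a rational fraction. -/

namespace RatFunc

variable {k : Type*} [Field k] (S : RatFunc k)

lemma aeval_denom_ne_zero {F : Type*} [Field F] [Algebra k F] {x c : F}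
    (h : aeval x S.num = c * aeval x S.denom) : aeval x S.denom ≠ 0 := by
  intro h0
  obtain ⟨u, v, huv⟩ := S.isCoprime_num_denom
  have := congrArg (aeval x) huv
  rw [map_add, map_mul, map_mul, h, h0, mul_zero, mul_zero, mul_zero, add_zero, map_one] at this
  exact zero_ne_one this

/-- All but one of the fibres of `S` have as many points, with multiplicity, as the degree of `S`
indicates. -/
lemma natDegree_num_sub_C_mul_denom {F : Type*} [Field F] [Algebra k F] {c : F}
    (hD : 0 < max S.num.natDegree S.denom.natDegree)
    (hc : c ≠ algebraMap k F (S.num.coeff (max S.num.natDegree S.denom.natDegree)) /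
      algebraMap k F (S.denom.coeff (max S.num.natDegree S.denom.natDegree))) :
    (S.num.map (algebraMap k F) - Polynomial.C c * S.denom.map (algebraMap k F)).natDegree =
      max S.num.natDegree S.denom.natDegree := by
  set D := max S.num.natDegree S.denom.natDegree with hDdef
  apply natDegree_eq_of_le_of_coeff_ne_zero
  · refine (natDegree_sub_le _ _).trans (max_le ?_ ?_)
    · rw [natDegree_map]
      exact le_max_left _ _
    · refine (natDegree_C_mul_le _ _).trans ?_
      rw [natDegree_map]
      exact le_max_right _ _
  · rw [coeff_sub, coeff_C_mul, coeff_map, coeff_map, sub_ne_zero]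
    -- The excluded value is S(∞). If S has a pole there, division by zero turns it into 0, a
    -- harmless extra exclusion.
    by_cases hb : S.denom.coeff D = 0
    · rw [hb, map_zero, mul_zero, Ne, map_eq_zero]
      intro ha
      rcases max_choice S.num.natDegree S.denom.natDegree with h | h
      · rw [← hDdef] at h
        rw [h, coeff_natDegree, leadingCoeff_eq_zero] at ha
        rw [h, ha, natDegree_zero] at hD
        exact lt_irrefl _ hD
      · rw [← hDdef] at h
        rw [h, coeff_natDegree, leadingCoeff_eq_zero] at hb
        exact S.denom_ne_zero hb
    · intro h
      apply hc
      rw [h, mul_div_cancel_right₀]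
      rwa [Ne, map_eq_zero]

/-- If S' = 0, coprimality forces the numerator and denominator of S to have zero derivative, and
then so does the transform; an irreducible polynomial over a perfect field is separable. -/
lemma derivative_ne_zero_of_irreducible_transform [PerfectField k] {f : k[X]}
    (h : Irreducible (S.transform f)) :
    derivative S.num * S.denom - S.num * derivative S.denom ≠ 0 := by
  have key : ∀ {p q : k[X]}, IsCoprime p q → derivative p * q = p * derivative q →
      derivative p = 0 := by
    intro p q hpq he
    rw [← Polynomial.dvd_derivative_iff]
    exact hpq.dvd_of_dvd_mul_right ⟨_, he⟩
  intro hw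
  rw [sub_eq_zero] at hw
  have ha := key S.isCoprime_num_denom hw
  have hb : derivative S.denom = 0 :=
    key S.isCoprime_num_denom.symm (by rw [mul_comm, ← hw, mul_comm])
  have hH : derivative (S.homogNum f) = 0 := by
    rw [homogNum, derivative_sum]
    refine Finset.sum_eq_zero fun i _ => ?_
    simp [derivative_mul, derivative_pow, ha, hb]
  have h1 := (num_mul_eq_mul_denom_iff (pow_ne_zero f.natDegree S.denom_ne_zero)).mpr
    (S.aeval_eq_div f)
  have h2 := congrArg derivative h1
  rw [derivative_mul, derivative_mul, derivative_pow, hb, hH, mul_zero, mul_zero, zero_mul,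
    add_zero, zero_add] at h2
  have h3 : derivative (S.transform f) = 0 := by
    apply key (aeval S f).isCoprime_num_denom
    apply mul_right_cancel₀ (pow_ne_zero f.natDegree S.denom_ne_zero)
    linear_combination (aeval S f).denom * h2 - derivative (aeval S f).denom * h1
  have h4 : (S.transform f).Separable := PerfectField.separable_of_irreducible h
  rw [Polynomial.separable_def, h3, isCoprime_zero_right] at h4
  exact h.not_isUnit h4

end RatFunc

/-! ### Surjectivity and the order of the kernel. -/

namespace WeierstrassCurve.Affine

variable {k : Type*} [Field k]

lemma exists_nonsingular (W : Affine k) [W.IsElliptic] (x : AlgebraicClosure k) :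
    ∃ y, (W.baseChange (AlgebraicClosure k)).Nonsingular x y := by
  set V := W.baseChange (AlgebraicClosure k) with hV
  have : V.IsElliptic :=
    inferInstanceAs (WeierstrassCurve.map W (algebraMap k (AlgebraicClosure k))).IsElliptic
  have hq : (C (1 : AlgebraicClosure k) * X ^ 2 + C (V.a₁ * x + V.a₃) * X +
      C (-(x ^ 3 + V.a₂ * x ^ 2 + V.a₄ * x + V.a₆))).degree = 2 :=
    degree_quadratic one_ne_zero
  obtain ⟨y, hy⟩ := IsAlgClosed.exists_root _ (by rw [hq]; decide)
  simp only [IsRoot.def, eval_add, eval_mul, eval_C, eval_X, eval_pow] at hy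
  refine ⟨y, equation_iff_nonsingular.mp ?_⟩
  rw [equation_iff]
  linear_combination hy

instance (W : Affine k) [W.IsElliptic] : Infinite W.GeomPoint := by
  have : Infinite (AlgebraicClosure k) := IsAlgClosed.instInfinite
  choose y hy using W.exists_nonsingular
  refine Infinite.of_injective (fun x => (.some x (y x) (hy x) : W.GeomPoint)) fun x x' h => ?_
  rw [Point.some.injEq] at h
  exact h.1

lemma finite_setOf_x_mem (W : Affine k) {Z : Set (AlgebraicClosure k)} (hZ : Z.Finite) :
    {T : W.GeomPoint | ∃ x ∈ Z, ∃ y h, T = .some x y h}.Finite := by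
  have : {T : W.GeomPoint | ∃ x ∈ Z, ∃ y h, T = .some x y h} =
      ⋃ x ∈ Z, {T : W.GeomPoint | ∃ y h, T = .some x y h} := by
    ext T
    simp
  rw [this]
  refine hZ.biUnion fun x _ => ?_
  by_cases hne : ∃ y, (W.baseChange (AlgebraicClosure k)).Nonsingular x y
  · obtain ⟨y, h⟩ := hne
    refine ((Set.finite_singleton (-(.some x y h : W.GeomPoint))).insert (.some x y h)).subset ?_
    rintro _ ⟨y', h', rfl⟩
    exact Point.X_eq_iff.mp rfl
  · refine Set.finite_empty.subset ?_
    rintro _ ⟨y', h', rfl⟩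
    exact hne ⟨y', h'⟩

namespace NonzeroEnd

variable {W : Affine k} [W.IsElliptic] (φ : W.NonzeroEnd)

lemma pullback_xFun_mul :
    φ.pullback W.xFun *
        algebraMap W.CoordinateRing W.FunctionField (CoordinateRing.mk W (C φ.xCoordMap.denom)) =
      algebraMap W.CoordinateRing W.FunctionField (CoordinateRing.mk W (C φ.xCoordMap.num)) := by
  rw [φ.pullback_xFun, ← aeval_xFun, ← aeval_xFun, div_mul_cancel₀]
  rw [aeval_xFun]
  exact W.algebraMap_mk_C_ne_zero φ.xCoordMap.denom_ne_zero

lemma aeval_num_eq_of_toHom_eq {x y x' y' : AlgebraicClosure k}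
    {h : (W.baseChange (AlgebraicClosure k)).Nonsingular x y}
    {h' : (W.baseChange (AlgebraicClosure k)).Nonsingular x' y'}
    (he : φ.toHom (.some x y h) = .some x' y' h') :
    aeval x φ.xCoordMap.num = x' * aeval x φ.xCoordMap.denom := by
  rw [φ.toHom_some_iff] at he
  obtain ⟨⟨a, b, hb, hab, hx'⟩, -⟩ := he
  have hmk : CoordinateRing.mk W (C φ.xCoordMap.num * b) =
      CoordinateRing.mk W (a * C φ.xCoordMap.denom) := by
    apply IsFractionRing.injective W.CoordinateRing W.FunctionField
    rw [map_mul, map_mul, map_mul, map_mul, ← φ.pullback_xFun_mul, ← hab]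
    ring
  have h1 := aevalAeval_eq_of_mk_eq h.1 hmk
  rw [map_mul, map_mul, aevalAeval_C, aevalAeval_C] at h1
  rw [hx', div_mul_eq_mul_div, eq_div_iff hb, h1]

/-- Away from the zeros of d₁ d₂ both coordinates of φ are regular. Their values satisfy the
Weierstrass equation, as one sees by pulling it back, clearing denominators and evaluating. -/
lemma exists_toHom_eq_some : ∃ g : k[X], g ≠ 0 ∧ ∀ (x y : AlgebraicClosure k)
    (h : (W.baseChange (AlgebraicClosure k)).Nonsingular x y), aeval x g ≠ 0 →
    ∃ x' y' h', φ.toHom (.some x y h) = .some x' y' h' := by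
  obtain ⟨p₁, q₁, d₁, hd₁, h₁⟩ := W.exists_smul_basis_div (φ.pullback W.xFun)
  obtain ⟨p₂, q₂, d₂, hd₂, h₂⟩ := W.exists_smul_basis_div (φ.pullback W.yFun)
  have : (W.baseChange (AlgebraicClosure k)).IsElliptic :=
    inferInstanceAs (WeierstrassCurve.map W (algebraMap k (AlgebraicClosure k))).IsElliptic
  refine ⟨d₁ * d₂, mul_ne_zero hd₁ hd₂, fun x y h hx => ?_⟩
  rw [map_mul, mul_ne_zero_iff] at hx
  obtain ⟨hx1, hx2⟩ := hx
  have heq : (W.baseChange (AlgebraicClosure k)).Equation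
      ((aeval x p₁ + aeval x q₁ * y) / aeval x d₁)
      ((aeval x p₂ + aeval x q₂ * y) / aeval x d₂) := by
    have E := congrArg φ.pullback W.yFun_equation
    simp only [map_add, map_mul, map_pow, AlgHom.commutes] at E
    set u := φ.pullback W.xFun
    set v := φ.pullback W.yFun
    set ι := algebraMap W.CoordinateRing W.FunctionField with hι
    set A : k[X][Y] := C p₁ + C q₁ * Y with hA
    set B : k[X][Y] := C p₂ + C q₂ * Y with hB
    have hC : ∀ a : k, algebraMap k W.FunctionField a = ι (CoordinateRing.mk W (C (C a))) :=
      fun a => rfl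
    have M : CoordinateRing.mk W (B ^ 2 * C d₁ ^ 3 + C (C W.a₁) * A * B * C d₁ ^ 2 * C d₂ +
          C (C W.a₃) * B * C d₁ ^ 3 * C d₂) =
        CoordinateRing.mk W (A ^ 3 * C d₂ ^ 2 + C (C W.a₂) * A ^ 2 * C d₁ * C d₂ ^ 2 +
          C (C W.a₄) * A * C d₁ ^ 2 * C d₂ ^ 2 + C (C W.a₆) * C d₁ ^ 3 * C d₂ ^ 2) := by
      apply IsFractionRing.injective W.CoordinateRing W.FunctionField
      simp only [map_add _ (_ : k[X][Y]), map_mul, map_pow, ← hι]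
      simp only [map_add ι, map_mul, map_pow, ← hC]
      rw [← h₁, ← h₂]
      linear_combination (ι (CoordinateRing.mk W (C d₁)) ^ 3 *
        ι (CoordinateRing.mk W (C d₂)) ^ 2) * E
    have N := aevalAeval_eq_of_mk_eq h.1 M
    simp only [hA, hB, map_add, map_mul, map_pow, aevalAeval_C, aevalAeval_Y, aeval_C] at N
    rw [equation_iff]
    simp only [WeierstrassCurve.baseChange, map_a₁, map_a₂, map_a₃, map_a₄, map_a₆]
    field_simp
    linear_combination N
  refine ⟨_, _, equation_iff_nonsingular.mp heq, ?_⟩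
  rw [φ.toHom_some_iff]
  exact ⟨⟨_, C d₁, by simpa using hx1, h₁, by simp⟩, ⟨_, C d₂, by simpa using hx2, h₂, by simp⟩⟩

/-- Away from finitely many values, every solution of `S(x) = x₀` lifts to a preimage under `φ` of
a given point with `x`-coordinate `x₀`. -/
lemma exists_finite_forall_lift (hD : 0 < φ.degree) : ∃ Z : Set (AlgebraicClosure k), Z.Finite ∧
    ∀ (x₀ y₀ : AlgebraicClosure k) (h₀ : (W.baseChange (AlgebraicClosure k)).Nonsingular x₀ y₀),
      x₀ ∉ Z →
      (φ.xCoordMap.num.map (algebraMap k (AlgebraicClosure k)) -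
        C x₀ * φ.xCoordMap.denom.map (algebraMap k (AlgebraicClosure k))).natDegree = φ.degree ∧
      ∀ x, aeval x φ.xCoordMap.num = x₀ * aeval x φ.xCoordMap.denom →
        ∃ y h, φ.toHom (.some x y h) = .some x₀ y₀ h₀ := by
  obtain ⟨g, hg0, hg⟩ := φ.exists_toHom_eq_some
  rw [φ.degree_eq_max_natDegree] at hD ⊢
  set D := max φ.xCoordMap.num.natDegree φ.xCoordMap.denom.natDegree
  set c := algebraMap k (AlgebraicClosure k) (φ.xCoordMap.num.coeff D) /
      algebraMap k (AlgebraicClosure k) (φ.xCoordMap.denom.coeff D)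
  -- Avoid S(∞), where the fibre loses points, and the images of the zeros of g, where φ may fail to
  -- be affine.
  refine ⟨insert c ((fun x => aeval x φ.xCoordMap.num / aeval x φ.xCoordMap.denom) ''
    (g.rootSet (AlgebraicClosure k))), ((g.rootSet_finite _).image _).insert _, ?_⟩
  intro x₀ y₀ h₀ hx₀
  rw [Set.mem_insert_iff, not_or] at hx₀
  refine ⟨RatFunc.natDegree_num_sub_C_mul_denom _ hD hx₀.1, fun x hx => ?_⟩
  have hb := φ.xCoordMap.aeval_denom_ne_zero hx
  have hgx : aeval x g ≠ 0 := by
    intro h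
    exact hx₀.2 ⟨x, (mem_rootSet.mpr ⟨hg0, h⟩), by simp only [hx, mul_div_cancel_right₀ _ hb]⟩
  obtain ⟨y, h⟩ := W.exists_nonsingular x
  obtain ⟨x', y', h', he⟩ := hg x y h hgx
  have hx' : x' = x₀ := by
    have := φ.aeval_num_eq_of_toHom_eq he
    rw [hx] at this
    exact (mul_right_cancel₀ hb this).symm
  rcases (Point.X_eq_iff (h₁ := h') (h₂ := h₀)).mp hx' with e | e
  · exact ⟨y, h, he.trans e⟩
  · refine ⟨_, (nonsingular_neg ..).mpr h, ?_⟩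
    rw [← Point.neg_some h, map_neg, he, e, neg_neg]

/-- The range misses only finitely many points. The group being infinite, any P is T + (P - T) with
both summands in the range. -/
lemma toHom_surjective (hD : 0 < φ.degree) : Function.Surjective φ.toHom := by
  obtain ⟨Z, hZ, hlift⟩ := φ.exists_finite_forall_lift hD
  have hfin : {T : W.GeomPoint | T ∉ φ.toHom.range}.Finite := by
    refine (W.finite_setOf_x_mem hZ).subset ?_
    intro T hT
    rcases T with _ | ⟨x₀, y₀, h₀⟩
    · exact absurd (zero_mem _) hT
    refine ⟨x₀, ?_, y₀, h₀, rfl⟩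
    by_contra hx₀
    obtain ⟨hdeg, hl⟩ := hlift x₀ y₀ h₀ hx₀
    obtain ⟨x, hx⟩ := IsAlgClosed.exists_root _ (natDegree_pos_iff_degree_pos.mp
      (hdeg ▸ hD)).ne'
    rw [IsRoot.def, eval_sub, eval_mul, eval_C, eval_map_algebraMap, eval_map_algebraMap,
      sub_eq_zero] at hx
    obtain ⟨y, h, he⟩ := hl x hx
    exact hT ⟨_, he⟩
  intro P
  have hfin' : {T : W.GeomPoint | P - T ∉ φ.toHom.range}.Finite :=
    hfin.preimage (f := fun T => P - T) (sub_right_injective.injOn)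
  obtain ⟨T, hT⟩ := (hfin.union hfin').exists_notMem
  simp only [Set.mem_union, Set.mem_ofPred_eq, not_or, not_not] at hT
  have := add_mem hT.1 hT.2
  rw [add_sub_cancel] at this
  exact this

/-- The kernel is in bijection with the fibre over a generic point (x₀, y₀). There x is injective
because the point is not its own negative, and S = x₀ has exactly deg φ distinct solutions, all of
which lift. -/
lemma card_ker (hD : 0 < φ.degree)
    (hw : derivative φ.xCoordMap.num * φ.xCoordMap.denom -
      φ.xCoordMap.num * derivative φ.xCoordMap.denom ≠ 0) :
    Nat.card φ.toHom.ker = φ.degree := by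
  classical
  obtain ⟨Z, hZ, hlift⟩ := φ.exists_finite_forall_lift hD
  have : (W.baseChange (AlgebraicClosure k)).IsElliptic :=
    inferInstanceAs (WeierstrassCurve.map W (algebraMap k (AlgebraicClosure k))).IsElliptic
  set w := derivative φ.xCoordMap.num * φ.xCoordMap.denom -
      φ.xCoordMap.num * derivative φ.xCoordMap.denom with hwdef
  have hZ' : (Z ∪ (fun x => aeval x φ.xCoordMap.num / aeval x φ.xCoordMap.denom) ''
    (w.rootSet (AlgebraicClosure k))).Finite := hZ.union ((w.rootSet_finite _).image _)
  obtain ⟨x₀, y₀, heq, hx₀, hy₀⟩ := W.exists_point_of_ne_zero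
    -- The polynomial to avoid must have coefficients in k, so each forbidden value contributes its
    -- minimal polynomial.
    (g := ∏ z ∈ hZ'.toFinset, minpoly k z)
    (Finset.prod_ne_zero_iff.mpr fun z _ => minpoly.ne_zero (Algebra.IsIntegral.isIntegral z))
  have h₀ := equation_iff_nonsingular.mp heq
  have hx₀Z : x₀ ∉ Z ∪ (fun x => aeval x φ.xCoordMap.num / aeval x φ.xCoordMap.denom) ''
      (w.rootSet (AlgebraicClosure k)) := by
    intro h
    apply hx₀
    rw [map_prod]
    exact Finset.prod_eq_zero (hZ'.mem_toFinset.mpr h) (minpoly.aeval k x₀)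
  rw [Set.mem_union, not_or] at hx₀Z
  obtain ⟨hdeg, hl⟩ := hlift x₀ y₀ h₀ hx₀Z.1
  set p := φ.xCoordMap.num.map (algebraMap k (AlgebraicClosure k)) -
        C x₀ * φ.xCoordMap.denom.map (algebraMap k (AlgebraicClosure k)) with hp
  have hp0 : p ≠ 0 := by
    intro h
    rw [h, natDegree_zero] at hdeg
    omega
  have hroot : ∀ x, x ∈ p.roots ↔
      aeval x φ.xCoordMap.num = x₀ * aeval x φ.xCoordMap.denom := by
    intro x
    rw [mem_roots hp0, IsRoot.def, hp, eval_sub, eval_mul, eval_C, eval_map_algebraMap,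
      eval_map_algebraMap, sub_eq_zero]
  -- A multiple root is a zero of w, and x₀ avoids the values of S at those.
  have hnodup : p.roots.Nodup := by
    rw [Multiset.nodup_iff_count_le_one]
    intro x
    rw [count_roots]
    by_contra! hlt
    rw [one_lt_rootMultiplicity_iff_isRoot hp0] at hlt
    obtain ⟨hr, hr'⟩ := hlt
    have hx := (hroot x).mp ((mem_roots hp0).mpr hr)
    have hb := φ.xCoordMap.aeval_denom_ne_zero hx
    rw [hp, IsRoot.def, derivative_sub, derivative_C_mul, derivative_map, derivative_map,
      eval_sub, eval_mul, eval_C, eval_map_algebraMap, eval_map_algebraMap, sub_eq_zero] at hr'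
    refine hx₀Z.2 ⟨x, mem_rootSet.mpr ⟨hw, ?_⟩, by simp only [hx, mul_div_cancel_right₀ _ hb]⟩
    rw [hwdef, map_sub, map_mul, map_mul, hx, hr']
    ring
  have hcard : p.roots.toFinset.card = φ.degree := by
    rw [Multiset.toFinset_card_of_nodup hnodup, ← hdeg]
    exact (splits_iff_card_roots.mp (IsAlgClosed.splits p))
  obtain ⟨Q₀, hQ₀⟩ := φ.toHom_surjective hD (.some x₀ y₀ h₀)
  have hfib : ∀ R : φ.toHom.ker, ∃ x y h, Q₀ + R = .some x y h := by
    rintro ⟨R, hR⟩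
    have he : φ.toHom (Q₀ + R) = .some x₀ y₀ h₀ := by
      rw [map_add, (AddMonoidHom.mem_ker).mp hR, add_zero, hQ₀]
    rcases hQ : Q₀ + R with _ | ⟨x, y, h⟩
    · rw [hQ] at he
      rw [show (Point.zero : W.GeomPoint) = 0 from rfl, map_zero] at he
      cases he
    · exact ⟨x, y, h, rfl⟩
  choose x y h hxy using hfib
  have hval : ∀ R : φ.toHom.ker, φ.toHom (.some (x R) (y R) (h R)) = .some x₀ y₀ h₀ := by
    intro R
    rw [← hxy, map_add, (AddMonoidHom.mem_ker).mp R.2, add_zero, hQ₀]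
  have hmem : ∀ R, x R ∈ p.roots.toFinset := by
    intro R
    rw [Multiset.mem_toFinset, hroot]
    exact φ.aeval_num_eq_of_toHom_eq (hval R)
  have hbij : Function.Bijective (fun R => (⟨x R, hmem R⟩ : p.roots.toFinset)) := by
    constructor
    · intro R R' he
      have hxx : x R = x R' := congrArg Subtype.val he
      rcases (Point.X_eq_iff (h₁ := h R) (h₂ := h R')).mp hxx with e | e
      · rw [← hxy, ← hxy, add_right_inj] at e
        exact Subtype.ext e
      · exfalso
        have := congrArg φ.toHom e
        rw [map_neg, hval, hval, Point.neg_some, Point.some.injEq] at this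
        exact hy₀ this.2
    · rintro ⟨t, ht⟩
      rw [Multiset.mem_toFinset, hroot] at ht
      obtain ⟨y', h', he⟩ := hl t ht
      refine ⟨⟨.some t y' h' - Q₀, ?_⟩, ?_⟩
      · rw [AddMonoidHom.mem_ker, map_sub, he, hQ₀, sub_self]
      · apply Subtype.ext
        have := hxy ⟨.some t y' h' - Q₀, by
          rw [AddMonoidHom.mem_ker, map_sub, he, hQ₀, sub_self]⟩
        rw [add_sub_cancel, Point.some.injEq] at this
        exact this.1.symm
  rw [Nat.card_congr (Equiv.ofBijective _ hbij), Nat.card_eq_fintype_card, Fintype.card_coe, hcard]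

end NonzeroEnd

end WeierstrassCurve.Affine

/-! ### Frobenius periods of points and of their x-coordinates. -/

namespace WeierstrassCurve.Affine

variable {k : Type*} [Field k]

namespace GeomPoint

variable {W : Affine k} (σ : AlgebraicClosure k ≃ₐ[k] AlgebraicClosure k)

lemma galois_pow_some_eq_or_eq_neg {i : ℕ} {x y x' y' : AlgebraicClosure k}
    (h : (W.baseChange (AlgebraicClosure k)).Nonsingular x y)
    (h' : (W.baseChange (AlgebraicClosure k)).Nonsingular x' y') (hx : (σ ^ i) x = x') :
    (galois (W := W) σ ^ i) (.some x y h) = .some x' y' h' ∨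
      (galois (W := W) σ ^ i) (.some x y h) = -.some x' y' h' := by
  obtain ⟨h₁, e⟩ := galois_pow_some σ i h
  rw [e]
  exact Point.X_eq_iff.mp hx

lemma pow_apply_eq_of_galois_pow_some {i : ℕ} {x y : AlgebraicClosure k}
    {h : (W.baseChange (AlgebraicClosure k)).Nonsingular x y}
    (he : (galois (W := W) σ ^ i) (.some x y h) = .some x y h ∨
      (galois (W := W) σ ^ i) (.some x y h) = -.some x y h) : (σ ^ i) x = x := by
  obtain ⟨h₁, e⟩ := galois_pow_some σ i h
  rw [e] at he
  exact Point.X_eq_iff.mpr he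

lemma exists_period (P : W.GeomPoint) : ∃ m, (galois σ ^ m) P = P ∧
    ∀ i, (galois σ ^ i) P = P → m ∣ i := by
  -- Were P not periodic, this would be 0, and both claims would still hold; positivity is recovered
  -- where it is needed.
  refine ⟨Function.minimalPeriod (galois σ) P, ?_, fun i hi => ?_⟩
  · rw [AddMonoid.End.coe_pow]
    exact Function.isPeriodicPt_minimalPeriod _ _
  · rw [AddMonoid.End.coe_pow] at hi
    exact Function.IsPeriodicPt.minimalPeriod_dvd hi

end GeomPoint

variable {W : Affine k}

lemma NonzeroEnd.exists_eq_some_of_toHom_eq (φ : W.NonzeroEnd) {Q : W.GeomPoint} {x y : AlgebraicClosure k}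
    {h : (W.baseChange (AlgebraicClosure k)).Nonsingular x y} (he : φ.toHom Q = .some x y h) :
    ∃ x' y' h', Q = .some x' y' h' := by
  rcases Q with _ | ⟨x', y', h'⟩
  · rw [show (Point.zero : W.GeomPoint) = 0 from rfl, map_zero] at he
    cases he
  · exact ⟨x', y', h', rfl⟩

/-- If the period of a point `Q` over `P` under `σ` is divisible by the product of the period of `P`
with an odd number `M`, the same holds for the periods of the `x`-coordinates, the period of `x_P`
being bounded below by its degree. -/
lemma natDegree_minpoly_mul_le {σ : AlgebraicClosure k ≃ₐ[k] AlgebraicClosure k}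
    (hσ : ∀ z, σ z = z → z ∈ Set.range (algebraMap k (AlgebraicClosure k)))
    {ψ : W.GeomPoint →+ W.GeomPoint}
    (hψ : ∀ i Q, ψ ((GeomPoint.galois σ ^ i) Q) = (GeomPoint.galois σ ^ i) (ψ Q))
    {x y xP yP : AlgebraicClosure k} {h : (W.baseChange (AlgebraicClosure k)).Nonsingular x y}
    {hP : (W.baseChange (AlgebraicClosure k)).Nonsingular xP yP}
    (hQ : ψ (.some x y h) = .some xP yP hP) {m M : ℕ} (hM : Odd M)
    (hm : (GeomPoint.galois σ ^ m) (.some xP yP hP : W.GeomPoint) = .some xP yP hP)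
    (hdvd : ∀ i, (GeomPoint.galois σ ^ i) (.some x y h : W.GeomPoint) = .some x y h → m * M ∣ i)
    {i : ℕ} (hi : 0 < i) (hx : (σ ^ i) x = x) :
    M * (minpoly k xP).natDegree ≤ i := by
  have hxP : (σ ^ m) xP = xP := GeomPoint.pow_apply_eq_of_galois_pow_some σ (.inl hm)
  have hbig : ∀ t, i = m * M * t → M * (minpoly k xP).natDegree ≤ i := by
    intro t ht
    have hm0 : 0 < m := by
      rcases Nat.eq_zero_or_pos m with rfl | h
      · simp at ht
        omega
      · exact h
    have ht0 : 0 < t := by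
      rcases Nat.eq_zero_or_pos t with rfl | h
      · omega
      · exact h
    calc M * (minpoly k xP).natDegree ≤ M * m :=
          Nat.mul_le_mul_left _ (σ.natDegree_minpoly_le hσ hm0 hxP)
      _ = m * M := mul_comm _ _
      _ ≤ m * M * t := Nat.le_mul_of_pos_right _ ht0
      _ = i := ht.symm
  rcases GeomPoint.galois_pow_some_eq_or_eq_neg σ h h hx with e | e
  · obtain ⟨t, ht⟩ := hdvd i e
    exact hbig t ht
  have h2 : (GeomPoint.galois σ ^ (i + i)) (.some x y h : W.GeomPoint) = .some x y h := by
    rw [pow_add, AddMonoid.End.apply_mul, e, map_neg, e, neg_neg]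
  obtain ⟨j, hj⟩ := hdvd _ h2
  rcases Nat.even_or_odd' j with ⟨t, rfl | rfl⟩
  · exact hbig t (by linarith)
  -- Remaining case: σ^i Q = -Q and 2i = m M j with j odd. As M is odd, m = 2r is even, and i is an
  -- odd multiple of r.
  have hmeven : Even m := by
    have : Even (m * M * (2 * t + 1)) := ⟨i, hj.symm⟩
    rw [Nat.even_mul, Nat.even_mul] at this
    rcases this with (h | h) | h
    · exact h
    · exact absurd h (Nat.not_even_iff_odd.mpr hM)
    · exact absurd h (by simp)
  obtain ⟨r, hr⟩ := hmeven
  have hir : i = r * (M * (2 * t + 1)) := by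
    have : i + i = r * (M * (2 * t + 1)) + r * (M * (2 * t + 1)) := by rw [hj, hr]; ring
    omega
  obtain ⟨s, hs⟩ : Odd (M * (2 * t + 1)) := hM.mul ⟨t, rfl⟩
  have hr0 : 0 < r := by
    rcases Nat.eq_zero_or_pos r with rfl | h
    · omega
    · exact h
  -- Writing i = r + m s', with s' the present s, σ^i acts on P as σ^r, so ψ turns σ^i Q = -Q into
  -- σ^r P = -P. Thus x_P already has period r = m/2, which makes up for the factor 2 lost in i.
  have hrP : (σ ^ r) xP = xP := by
    apply GeomPoint.pow_apply_eq_of_galois_pow_some σ (h := hP)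
    right
    have h3 := congrArg ψ e
    rw [hψ, map_neg, hQ, hir, hs, show r * (2 * s + 1) = r + m * s by rw [hr]; ring, pow_add,
      AddMonoid.End.apply_mul, pow_mul, AddMonoid.End.pow_apply_eq_self hm] at h3
    exact h3
  calc M * (minpoly k xP).natDegree ≤ M * r :=
        Nat.mul_le_mul_left _ (σ.natDegree_minpoly_le hσ hr0 hrP)
    _ = r * M := mul_comm _ _
    _ ≤ r * (M * (2 * t + 1)) := Nat.mul_le_mul_left _ (Nat.le_mul_of_pos_right _ (by omega))
    _ = i := hir.symm

end WeierstrassCurve.Affine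

/-! ### Iterated transforms and the conclusion. -/

namespace RatFunc

variable {k : Type*} [Field k] {S : RatFunc k}

lemma transform_iterate_ne_zero (hS : ¬∃ c, S = C c) {f : k[X]} (hf : f ≠ 0) (n : ℕ) :
    S.transform^[n] f ≠ 0 := by
  induction n with
  | zero => exact hf
  | succ n ih =>
    rw [Function.iterate_succ_apply']
    exact transform_ne_zero hS ih

lemma natDegree_transform_iterate_le (f : k[X]) (n : ℕ) :
    (S.transform^[n] f).natDegree ≤ max S.num.natDegree S.denom.natDegree ^ n * f.natDegree := by
  induction n with
  | zero => simp
  | succ n ih =>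
    rw [Function.iterate_succ_apply', pow_succ', mul_assoc]
    exact (natDegree_transform_le _).trans (Nat.mul_le_mul_left _ ih)

end RatFunc

/-- Separability is not used directly: it already follows from the irreducibility of the transform,
see `RatFunc.derivative_ne_zero_of_irreducible_transform`. -/
theorem mainTheorem2 {k : Type*} [Field k] [Finite k]
    (W : WeierstrassCurve.Affine k) [W.IsElliptic]
    (φ : W.NonzeroEnd) (hsep : φ.IsSeparable) (hodd : Odd φ.degree)
    (xP yP : AlgebraicClosure k)
    (hP : (W.baseChange (AlgebraicClosure k)).Nonsingular xP yP)
    (hcyc : IsAddCyclic (φ.toHom.comp φ.toHom).ker)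
    (hrat : ∀ R ∈ (φ.toHom.comp φ.toHom).ker,
      WeierstrassCurve.Affine.fieldOfDef R ≤
        WeierstrassCurve.Affine.fieldOfDef (W := W) (.some xP yP hP))
    (hirr : Irreducible (φ.xCoordMap.transform (minpoly k xP))) (n : ℕ) :
    Irreducible (φ.xCoordMap.transform^[n] (minpoly k xP)) := by
  open WeierstrassCurve.Affine in
  set S := φ.xCoordMap with hSdef
  have hD : 0 < φ.degree := hodd.pos
  have hcard := φ.card_ker hD (S.derivative_ne_zero_of_irreducible_transform hirr)
  have hSC : ¬∃ c, S = RatFunc.C c := by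
    rw [RatFunc.eq_C_iff, ← Nat.max_eq_zero_iff, ← φ.degree_eq_max_natDegree]
    exact hD.ne'
  obtain ⟨σ, hσ⟩ := FiniteField.exists_algEquiv_fixed_eq_range k (AlgebraicClosure k)
  have hcomm : ∀ Q, φ.toHom (GeomPoint.galois σ Q) = GeomPoint.galois σ (φ.toHom Q) :=
    φ.toHom_galois σ
  set P : W.GeomPoint := .some xP yP hP with hPdef
  obtain ⟨m, hmP, hmdvd⟩ := GeomPoint.exists_period σ P
  obtain ⟨s, hs⟩ := (φ.toHom_surjective hD).hasRightInverse
  set Q : ℕ → W.GeomPoint := fun n => s^[n] P with hQdef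
  have hQ : ∀ n, φ.toHom (Q (n + 1)) = Q n := by
    intro n
    simp only [hQdef, Function.iterate_succ_apply']
    exact hs _
  have haff : ∀ n, ∃ x y h, Q n = .some x y h := by
    intro n
    induction n with
    | zero => exact ⟨xP, yP, hP, rfl⟩
    | succ n ih =>
      obtain ⟨x, y, h, e⟩ := ih
      exact φ.exists_eq_some_of_toHom_eq ((hQ n).trans e)
  choose x y h hxy using haff
  have hlift : ∀ {g : Polynomial k} {u v u' v' : AlgebraicClosure k} {hu hu'},
      φ.toHom (.some u v hu) = .some u' v' hu' → Polynomial.aeval u' g = 0 →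
      Polynomial.aeval u (S.transform g) = 0 := by
    intro g u v u' v' hu hu' he hg
    have h1 := φ.aeval_num_eq_of_toHom_eq he
    exact RatFunc.aeval_transform_eq_zero (S.aeval_denom_ne_zero h1) h1 hg
  have hroot : ∀ n, Polynomial.aeval (x n) (S.transform^[n] (minpoly k xP)) = 0 := by
    intro n
    induction n with
    | zero =>
      have e : (Point.some xP yP hP : W.GeomPoint) = .some (x 0) (y 0) (h 0) := hxy 0
      rw [Point.some.injEq] at e
      rw [← e.1]
      exact minpoly.aeval k xP
    | succ n ih =>
      rw [Function.iterate_succ_apply']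
      have e := hQ n
      rw [hxy (n + 1), hxy n] at e
      exact hlift e ih
  have hfix : ∀ R, φ.toHom (φ.toHom R) = 0 → (GeomPoint.galois σ ^ m) R = R := fun R hR =>
    GeomPoint.galois_pow_eq_self σ m (hrat R hR) hmP
  have hord : addOrderOf ((GeomPoint.galois σ ^ m) (Q 1) - Q 1) = φ.degree := by
    refine addOrderOf_pow_sub_of_orbit hcomm hcard hodd (by rw [hQ 0]; exact hmP)
      (by rw [hQ 0]; exact hmdvd) (fun R hR => hfix R (by rw [hR, map_zero])) fun R hR => ?_
    have he : φ.toHom (Q 1 + R) = .some xP yP hP := by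
      rw [map_add, hR, add_zero, hQ 0]
      rfl
    obtain ⟨u, v, hu, hR'⟩ := φ.exists_eq_some_of_toHom_eq he
    have hu0 : Polynomial.aeval u (S.transform (minpoly k xP)) = 0 :=
      hlift (hR' ▸ he) (minpoly.aeval k xP)
    -- By irreducibility the transform is, up to a constant, the minimal polynomial of x(Q_1), so u
    -- is conjugate to x(Q_1).
    have hu1 : Polynomial.aeval u (minpoly k (x 1)) = 0 := by
      rw [← minpoly.eq_of_irreducible hirr (hroot 1), map_mul, hu0, zero_mul]
    obtain ⟨i, hi⟩ := σ.exists_pow_apply_eq_of_aeval_minpoly hσ hu1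
    refine ⟨i, ?_⟩
    rw [hR', hxy 1]
    exact GeomPoint.galois_pow_some_eq_or_eq_neg σ (h 1) hu hi
  have hdvd := dvd_of_pow_apply_eq_tower hcomm hcyc hcard hD hfix hQ hmP hmdvd hord n
  -- The map ψ is the n-th iterate of φ.
  obtain ⟨ψ, hψQ, hψ⟩ : ∃ ψ : W.GeomPoint →+ W.GeomPoint, ψ (Q n) = P ∧
      ∀ i Q, ψ ((GeomPoint.galois σ ^ i) Q) = (GeomPoint.galois σ ^ i) (ψ Q) := by
    clear hdvd
    induction n with
    | zero => exact ⟨AddMonoidHom.id _, rfl, fun _ _ => rfl⟩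
    | succ n ih =>
      obtain ⟨ψ, hψQ, hψ⟩ := ih
      exact ⟨ψ.comp φ.toHom, by rw [AddMonoidHom.comp_apply, hQ, hψQ], fun i Q => by
        rw [AddMonoidHom.comp_apply, AddMonoidHom.comp_apply,
          AddMonoid.End.map_pow_apply hcomm, hψ]⟩
  obtain ⟨i, hi, hile, hix⟩ := σ.exists_pow_apply_eq_le_natDegree_minpoly (x n)
  rw [hxy n] at hψQ hdvd
  have hle := natDegree_minpoly_mul_le hσ hψ hψQ hodd.pow hmP hdvd hi hix
  have hdeg := RatFunc.natDegree_transform_iterate_le (S := S) (minpoly k xP) n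
  rw [← φ.degree_eq_max_natDegree] at hdeg
  have h0 := RatFunc.transform_iterate_ne_zero hSC
    (minpoly.ne_zero (Algebra.IsIntegral.isIntegral xP : IsIntegral k xP)) n
  -- The minimal polynomial of x(Q_n) divides the iterated transform, and deg T_S^n(f) ≤ d^n deg f ≤
  -- i ≤ deg x(Q_n) makes the two associated.
  exact (Polynomial.associated_of_dvd_of_natDegree_le (minpoly.dvd k _ (hroot n)) h0
    (hdeg.trans (hle.trans hile))).irreducible
    (minpoly.irreducible (Algebra.IsIntegral.isIntegral (x n)))
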